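/- Let $M$ be a smooth finite-dimensional manifold. A \emph{holomorphic symplectic form} on the real manifold $M$ is a smooth closed complex 2-form $\Omega$ with $T_{\mathbb C}M=\ker\Omega\oplus\ker\overline\Omega$. Let $\omega_+$ be a holomorphic symplectic form and $\omega_3$ a real field of bilinear forms on $M$, put $\omega_-=\overline{\omega_+}$, and suppose that $$\varpi(\zeta)=-\tfrac{i}{2\zeta}\,\omega_+ +\omega_3-\tfrac{i}{2}\zeta\,\omega_-$$ is a holomorphic symplectic form for every $\zeta\in\mathbb C^\times$. Put $\varpi(0)=\omega_+$, $\varpi(\infty)=\omega_-$. For $\zeta\in\mathbb P^1$ let $J^{(\zeta)}$ be the endomorphism of $TM$ that is $-i$ on $\ker\varpi(\zeta)$ and $i$ on $\ker\overline{\varpi(\zeta)}$; write $T^{(1,0)}M^{(\zeta)}$ and $T^{(0,1)}M^{(\zeta)}$ for its $\pm i$-eigenbundles in $T_{\mathbb C}M$. Let $J_1=J^{(i)}$, $J_2=J^{(-1)}$, $J_3=J^{(0)}$, $\omega_+=\omega_1+i\omega_2$ with $\omega_1,\omega_2$ real, and $$g(v,w)=\tfrac12\big(\omega_+(v,J_1w)-\omega_+(J_1v,w)\big).$$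 \textbf{The structure on $M$.} The form $g$ is real, and $(g,(J_\alpha),(\omega_\alpha))$ is a pseudo-hyper-Kähler structure on $M$: $g$ is a pseudo-Riemannian metric, the $J_\alpha$ are integrable complex structures satisfying the unit quaternion relations, the $\omega_\alpha$ are symplectic, $\omega_\alpha(v,w)=g(J_\alpha v,w)$, $g(v,w)=\omega_\alpha(v,J_\alpha w)$, and for each $\zeta\in\mathbb P^1$, with $c^{(\zeta)}=\frac{1}{1+|\zeta|^2}(2\,\mathrm{Im}\,\zeta,-2\,\mathrm{Re}\,\zeta,1-|\zeta|^2)$ (and $c^{(\infty)}=(0,0,-1)$), $\sum_\alpha c^{(\zeta)}_\alpha J_\alpha$ is an integrable complex structure and $\sum_\alpha c^{(\zeta)}_\alpha\omega_\alpha$ is symplectic. Moreover $J^{(\zeta)}=\sum_\alpha c^{(\zeta)}_\alpha J_\alpha$, $T^{(0,1)}M^{(\zeta)}=\ker\varpi(\zeta)$ and $T^{(1,0)}M^{(\zeta)}=\ker\overline{\varpi(\zeta)}$ for all $\zeta\in\mathbb P^1$. \textbf{The structure on twistor lines.} Consider the twistor space $Z=M\times\mathbb P^1$ with fibres $(M,J^{(\zeta)})$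 and real structure $(m,\zeta)\mapsto(m,-1/\bar\zeta)$. Fix $m\in M$, and let $N$ be the normal bundle of the twistor line $\{m\}\times\mathbb P^1$, i.e. the bundle over $\mathbb P^1$ with fibre $N_\zeta=T^{(1,0)}_mM^{(\zeta)}\subset T_{\mathbb C,m}M$. The bundle of $(1,0)$-covectors is a holomorphic subbundle of the trivial bundle with fibre $(T_{\mathbb C,m}M)^*$; a smooth section of $N$ is \emph{holomorphic} if its pairing with every local holomorphic section of that bundle is holomorphic, and a section $s$ of $N$ is \emph{real} if $\overline{s(\zeta)}=s(-1/\bar\zeta)$. Let $H_m$ be the real vector space of global real holomorphic sections of $N$, that is, the tangent space at $\{m\}\times\mathbb P^1$ of the space of real twistor lines. Over $\mathbb C$, represent $s$ by the $T^{(1,0)}_mM^{(0)}$-valued function $v(\zeta)$ given by the $(1,0)$-part, with respect to $J^{(0)}$, of $(1-\zeta J_1)s(\zeta)$; this is its coordinate under $N\cong T_m^{(1,0)}M^{(0)}\otimes\mathcal O(1)$. Then: (i) $\dim_{\mathbb R}T_mM=4r$ for some integer $r\ge 0$, and $N\cong\mathcal O(1)^{\oplus 2r}$. (ii) There is exactly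 one antilinear operator $j$ on $T^{(1,0)}_mM^{(0)}$ such that $j^2=-1$ and the coordinates of the elements of $H_m$ are exactly the functions $a-\zeta ja$ with $a\in T^{(1,0)}_mM^{(0)}$. It is $j(a)=J_1\bar a$. (iii) There is exactly one Hitchin--Karlhede--Lindström--Roček structure on $H_m$, namely: a real bilinear form $G$ with $$G(a-\zeta ja,\,b-\zeta jb)=\tfrac12\big(\omega_+(a,jb)-\omega_+(ja,b)\big),$$ where elements of $H_m$ are written in coordinates; for each $\zeta\in\mathbb P^1$ an endomorphism $I^{(\zeta)}$ of $H_m$ with $(I^{(\zeta)}s)(\zeta)=i\,s(\zeta)$, and the complex bilinear form $\Theta^{(\zeta)}(s,t)=\varpi(\zeta)(s(\zeta),t(\zeta))$; and the forms $\kappa_\alpha(s,t)=G(I_\alpha s,t)$, with $I_1=I^{(i)}$, $I_2=I^{(-1)}$, $I_3=I^{(0)}$. (iv) The map $\Phi:T_mM\to H_m$ that sends $v$ to the section $\zeta\mapsto$ ($(1,0)$-part of $v$ with respect to $J^{(\zeta)}$) is a real linear isomorphism; in coordinates $\Phi(v)$ is $a-\zeta J_1\bar a$, where $a$ is the $(1,0)$-part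 of $v$ with respect to $J^{(0)}$. It identifies the two structures: for all $v,w\in T_mM$, $\zeta\in\mathbb P^1$ and $\alpha=1,2,3$, $$G(\Phi v,\Phi w)=g(v,w),\quad I^{(\zeta)}\Phi v=\Phi(J^{(\zeta)}v),\quad \Theta^{(\zeta)}(\Phi v,\Phi w)=\varpi(\zeta)(v,w),\quad \kappa_\alpha(\Phi v,\Phi w)=\omega_\alpha(v,w).$$ -/

import Mathlib

open scoped Manifold ContDiff TensorProduct Bundle

noncomputable section

namespace HKTwistor

/-! ## Complexification of a real vector space -/

section LinearAlgebra

variable {V : Type*} [AddCommGroup V] [Module ℝ V]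

/-- The complexification `V_ℂ = ℂ ⊗ V` of a real vector space. -/
abbrev Cplx (V : Type*) [AddCommGroup V] [Module ℝ V] : Type _ := ℂ ⊗[ℝ] V

/-- A real vector, regarded as an element of the complexification. -/
def incl : V →ₗ[ℝ] Cplx V := TensorProduct.mk ℝ ℂ V 1

/-- Complex conjugation `λ ⊗ v ↦ conj λ ⊗ v` on the complexification. -/
def cconj : Cplx V →ₗ[ℝ] Cplx V :=
  LinearMap.rTensor V (Complex.conjAe.toLinearMap : ℂ →ₗ[ℝ] ℂ)

/-- The real part `λ ⊗ v ↦ Re λ • v`. -/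
def rePart : Cplx V →ₗ[ℝ] V :=
  (TensorProduct.lid ℝ V).toLinearMap ∘ₗ LinearMap.rTensor V Complex.reLm

/-- The complex-linear extension of a real endomorphism. -/
def cext (A : V →ₗ[ℝ] V) : Cplx V →ₗ[ℂ] Cplx V := A.baseChange ℂ

/-- The complex-bilinear extension of a real-bilinear complex-valued form. -/
def cform (B : V →ₗ[ℝ] V →ₗ[ℝ] ℂ) : Cplx V →ₗ[ℂ] Cplx V →ₗ[ℂ] ℂ :=
  LinearMap.liftBaseChange ℂ
    (((LinearMap.liftBaseChangeEquiv (R := ℝ) (M := V) (N := ℂ) ℂ).toLinearMap.restrictScalars ℝ)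
      ∘ₗ B)

/-- The complex conjugate of a complex-valued form, `(v, w) ↦ conj (B v w)` on real vectors. -/
def conjForm (B : V →ₗ[ℝ] V →ₗ[ℝ] ℂ) : V →ₗ[ℝ] V →ₗ[ℝ] ℂ :=
  B.compr₂ (Complex.conjAe.toLinearMap : ℂ →ₗ[ℝ] ℂ)

/-- The kernel of a complex 2-form `B`, regarded as a map `V_ℂ → V_ℂ^*`. -/
def kerForm (B : V →ₗ[ℝ] V →ₗ[ℝ] ℂ) : Submodule ℂ (Cplx V) := LinearMap.ker (cform B)

/-- The space of vectors of type `(1,0)`: the `i`-eigenspace of `J` on `V_ℂ`. -/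
def T10 (J : V →ₗ[ℝ] V) : Submodule ℂ (Cplx V) :=
  Module.End.eigenspace (cext J) Complex.I

/-- The space of vectors of type `(0,1)`: the `-i`-eigenspace of `J` on `V_ℂ`. -/
def T01 (J : V →ₗ[ℝ] V) : Submodule ℂ (Cplx V) :=
  Module.End.eigenspace (cext J) (-Complex.I)

/-- The space of covectors of type `(1,0)`: complex-linear functionals `φ` with `φ ∘ J = i φ`. -/
def coT10 (J : V →ₗ[ℝ] V) : Submodule ℂ (Module.Dual ℂ (Cplx V)) :=
  Module.End.eigenspace (cext J).dualMap Complex.I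

/-- The projection `½ (1 - i J)` of `V_ℂ` onto the vectors of type `(1,0)`, along those of
type `(0,1)`, for a complex structure `J`. -/
def proj10 (J : V →ₗ[ℝ] V) : Cplx V →ₗ[ℂ] Cplx V :=
  (2⁻¹ : ℂ) • (LinearMap.id - Complex.I • cext J)

open Classical in
/-- The endomorphism of `V` defined by a complex 2-form `B` with
`V_ℂ = ker B ⊕ ker (conj B)`: it acts as `i` on `ker (conj B)` and as `-i` on `ker B`
(junk value `0` if there is no such decomposition). -/
def assocJ (B : V →ₗ[ℝ] V →ₗ[ℝ] ℂ) : V →ₗ[ℝ] V :=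
  if h : IsCompl (kerForm (conjForm B)) (kerForm B) then
    rePart ∘ₗ
      ((Complex.I • ((kerForm (conjForm B)).subtype ∘ₗ Submodule.projectionOnto _ _ h)
        - Complex.I • ((kerForm B).subtype ∘ₗ Submodule.projectionOnto _ _ h.symm)
        ).restrictScalars ℝ) ∘ₗ incl
  else 0

end LinearAlgebra

/-! ## The Riemann sphere -/

section Sphere

/-- The Riemann sphere `ℙ¹ = ℂ ∪ {∞}`. -/
abbrev P1 : Type := OnePoint ℂ

/-- The affine coordinate chart around `0`. -/
def chart0 (z : ℂ) : P1 := (z : OnePoint ℂ)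

/-- The affine coordinate chart around `∞`, `w ↦ 1 / w`. -/
def chartInf (w : ℂ) : P1 := if w = 0 then OnePoint.infty else ((w⁻¹ : ℂ) : OnePoint ℂ)

/-- The antipodal map `ζ ↦ -1 / conj ζ`. -/
def antipode (p : P1) : P1 :=
  OnePoint.elim p (chart0 0) (fun z => chartInf (-(starRingEnd ℂ z)))

/-- Stereographic projection: the unit vector
`(2 Im ζ, -2 Re ζ, 1 - |ζ|²) / (1 + |ζ|²)` attached to `ζ`, and `(0, 0, -1)` for `ζ = ∞`. -/
def sphereVec (p : P1) : Fin 3 → ℝ :=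
  OnePoint.elim p ![0, 0, -1]
    (fun z => ![2 * z.im / (1 + ‖z‖ ^ 2), -2 * z.re / (1 + ‖z‖ ^ 2),
      (1 - ‖z‖ ^ 2) / (1 + ‖z‖ ^ 2)])

/-- The points `i, -1, 0` of the sphere, i.e. those with `sphereVec` a standard basis vector. -/
def basePt : Fin 3 → P1 := ![chart0 Complex.I, chart0 (-1), chart0 0]

/-- `f` is holomorphic on the (open) subset `U` of the sphere. -/
def HolFunOn (U : Set P1) (f : P1 → ℂ) : Prop :=
  DifferentiableOn ℂ (fun z => f (chart0 z)) (chart0 ⁻¹' U) ∧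
  DifferentiableOn ℂ (fun w => f (chartInf w)) (chartInf ⁻¹' U)

/-- `f` is smooth (in the real sense) on the (open) subset `U` of the sphere. -/
def SmoothFunOn (U : Set P1) (f : P1 → ℂ) : Prop :=
  ContDiffOn ℝ ∞ (fun z => f (chart0 z)) (chart0 ⁻¹' U) ∧
  ContDiffOn ℝ ∞ (fun w => f (chartInf w)) (chartInf ⁻¹' U)

end Sphere

/-! ## The normal bundle of a twistor line, its holomorphic and its real sections

Throughout, `V` stands for the tangent space `T_m M` at a point `m` and `J : ℙ¹ → End V` for the
family of complex structures on it. The twistor space is `M × ℙ¹` with fibre `(M, J ζ)` over `ζ`,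
and the normal bundle of the twistor line `{m} × ℙ¹` has fibre `T10 (J ζ)` over `ζ`. -/

section NormalBundle

variable {V : Type*} [AddCommGroup V] [Module ℝ V]

/-- Holomorphic sections over `U` of the bundle of `(1,0)`-covectors, a holomorphic subbundle of
the trivial bundle with fibre the dual of `V_ℂ`. -/
def IsHolCosection (J : P1 → V →ₗ[ℝ] V) (U : Set P1) (σ : P1 → Module.Dual ℂ (Cplx V)) : Prop :=
  (∀ p ∈ U, σ p ∈ coT10 (J p)) ∧ ∀ x : Cplx V, HolFunOn U (fun p => σ p x)

/-- Holomorphic sections over `U` of the normal bundle, with fibres `T10 (J p)`: smooth sections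
whose pairing with every local holomorphic section of the bundle of `(1,0)`-covectors is
holomorphic. -/
def IsHolSection (J : P1 → V →ₗ[ℝ] V) (U : Set P1) (s : P1 → Cplx V) : Prop :=
  (∀ p ∈ U, s p ∈ T10 (J p)) ∧
  (∀ φ : Module.Dual ℂ (Cplx V), SmoothFunOn U (fun p => φ (s p))) ∧
  ∀ U' : Set P1, IsOpen U' → U' ⊆ U → ∀ σ, IsHolCosection J U' σ →
    HolFunOn U' (fun p => σ p (s p))

/-- A section is real if it intertwines the antipodal map with complex conjugation (the map that
the real structure `(m, ζ) ↦ (m, -1 / conj ζ)` of the twistor space induces). -/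
def IsRealSection (s : P1 → Cplx V) : Prop := ∀ p, cconj (s p) = s (antipode p)

/-- The real vector space of real holomorphic sections of the normal bundle. -/
def realHolSections (J : P1 → V →ₗ[ℝ] V) : Submodule ℝ (P1 → Cplx V) where
  carrier := {s | IsHolSection J Set.univ s ∧ IsRealSection s}
  add_mem' := by
    rintro s t ⟨⟨hs1, hs2, hs3⟩, hs4⟩ ⟨⟨ht1, ht2, ht3⟩, ht4⟩
    refine ⟨⟨fun p hp => Submodule.add_mem _ (hs1 p hp) (ht1 p hp), fun φ => ?_, ?_⟩, fun p => ?_⟩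
    · simp only [Pi.add_apply, map_add]
      exact ⟨(hs2 φ).1.add (ht2 φ).1, (hs2 φ).2.add (ht2 φ).2⟩
    · intro U' hU hUU σ hσ
      simp only [Pi.add_apply, map_add]
      exact ⟨(hs3 U' hU hUU σ hσ).1.add (ht3 U' hU hUU σ hσ).1,
        (hs3 U' hU hUU σ hσ).2.add (ht3 U' hU hUU σ hσ).2⟩
    · simp only [Pi.add_apply, map_add, hs4 p, ht4 p]
  zero_mem' := by
    refine ⟨⟨fun p _ => Submodule.zero_mem _, fun φ => ?_, ?_⟩, fun p => ?_⟩
    · simp only [Pi.zero_apply, map_zero]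
      exact ⟨contDiffOn_const, contDiffOn_const⟩
    · intro U' hU hUU σ hσ
      simp only [Pi.zero_apply, map_zero]
      exact ⟨differentiableOn_const _, differentiableOn_const _⟩
    · simp only [Pi.zero_apply, map_zero]
  smul_mem' := by
    rintro c s ⟨⟨hs1, hs2, hs3⟩, hs4⟩
    have key : ∀ x : Cplx V, c • x = (c : ℂ) • x := fun x => (Complex.coe_smul c x).symm
    refine ⟨⟨fun p hp => ?_, fun φ => ?_, ?_⟩, fun p => ?_⟩
    · rw [Pi.smul_apply, key]
      exact Submodule.smul_mem _ _ (hs1 p hp)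
    · simp only [Pi.smul_apply, key, map_smul]
      exact ⟨ContDiffOn.smul (f := fun _ => (c : ℂ)) contDiffOn_const (hs2 φ).1,
        ContDiffOn.smul (f := fun _ => (c : ℂ)) contDiffOn_const (hs2 φ).2⟩
    · intro U' hU hUU σ hσ
      simp only [Pi.smul_apply, key, map_smul]
      exact ⟨DifferentiableOn.const_smul (hs3 U' hU hUU σ hσ).1 (c : ℂ),
        DifferentiableOn.const_smul (hs3 U' hU hUU σ hσ).2 (c : ℂ)⟩
    · simp only [Pi.smul_apply, map_smul, hs4 p]

/-- The normal bundle is isomorphic to `𝒪(1)^n`: there are holomorphic frames `e` over `ℙ¹ - {∞}`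
and `f` over `ℙ¹ - {0}` which are related as the standard trivialisations of `𝒪(1)^n` are,
`f = ζ e`. -/
def NormalBundleIsoO1 (J : P1 → V →ₗ[ℝ] V) (n : ℕ) : Prop :=
  ∃ e f : Fin n → P1 → Cplx V,
    (∀ k, IsHolSection J {OnePoint.infty}ᶜ (e k)) ∧
    (∀ k, IsHolSection J {chart0 0}ᶜ (f k)) ∧
    (∀ p ∈ ({OnePoint.infty}ᶜ : Set P1), LinearIndependent ℂ (fun k => e k p) ∧
      Submodule.span ℂ (Set.range fun k => e k p) = T10 (J p)) ∧
    (∀ p ∈ ({chart0 0}ᶜ : Set P1), LinearIndependent ℂ (fun k => f k p) ∧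
      Submodule.span ℂ (Set.range fun k => f k p) = T10 (J p)) ∧
    ∀ k, ∀ z : ℂ, z ≠ 0 → f k (chart0 z) = z • e k (chart0 z)

/-- The coordinate `v(ζ) ∈ T10 (J 0)` of a section `s` of the normal bundle over `ℂ`, in the
trivialisation that comes from its identification with `T10 (J 0) ⊗ 𝒪(1)`. This identification is
dual to the isomorphism `1 - ζ J₁'` from `coT10 (J 0)` to `coT10 (J ζ)`, i.e. `v(ζ)` is
characterised by `τ (v ζ) = τ ((1 - ζ J₁) (s ζ))` for all `τ ∈ coT10 (J 0)`. Here `J₁ = J i`. -/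
def coord (J : P1 → V →ₗ[ℝ] V) (s : P1 → Cplx V) (z : ℂ) : Cplx V :=
  proj10 (J (chart0 0)) (s (chart0 z) - z • cext (J (chart0 Complex.I)) (s (chart0 z)))

/-- `j` is an antilinear operator on `T10 (J 0)`, with `j² = -1`, such that the real holomorphic
sections of the normal bundle are those with coordinate of the form `a - ζ j a`. -/
structure IsQuaternionicOperator (J : P1 → V →ₗ[ℝ] V)
    (j : T10 (J (chart0 0)) →ₛₗ[starRingEnd ℂ] T10 (J (chart0 0))) : Prop where
  sq : ∀ a, j (j a) = -a
  sections : ∀ v : ℂ → Cplx V,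
    (∃ s ∈ realHolSections J, ∀ z : ℂ, coord J s z = v z) ↔
      ∃ a : T10 (J (chart0 0)), ∀ z : ℂ, v z = (a : Cplx V) - z • (j a : Cplx V)

/-- Data on a real vector space `W` (a tangent space of the space of twistor lines): a bilinear
form, endomorphisms and complex bilinear forms parametrised by `ℙ¹`, and a triple of
bilinear forms. -/
structure TangentData (W : Type*) [AddCommGroup W] [Module ℝ W] where
  metric : W →ₗ[ℝ] W →ₗ[ℝ] ℝ
  cplx : P1 → W →ₗ[ℝ] W
  symp : P1 → W →ₗ[ℝ] W →ₗ[ℝ] ℂ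
  kahler : Fin 3 → W →ₗ[ℝ] W →ₗ[ℝ] ℝ

/-- The Hitchin--Karlhede--Lindström--Roček structure on the tangent space to the space of real
twistor lines, i.e. on the space of real holomorphic sections of the normal bundle. Here `ϖ ζ` is
the holomorphic symplectic form on the fibre over `ζ`, with `ϖ 0 = ω₊`. -/
structure IsHKLR (J : P1 → V →ₗ[ℝ] V) (ϖ : P1 → V →ₗ[ℝ] V →ₗ[ℝ] ℂ)
    (j : T10 (J (chart0 0)) →ₛₗ[starRingEnd ℂ] T10 (J (chart0 0)))
    (S : TangentData (realHolSections J)) : Prop where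
  /-- `g (a - ζ j a, b - ζ j b) = ½ (ω₊(a, j b) - ω₊(j a, b))` -/
  metric_eq : ∀ (a b : T10 (J (chart0 0))) (s t : realHolSections J),
    (∀ z : ℂ, coord J s z = (a : Cplx V) - z • (j a : Cplx V)) →
    (∀ z : ℂ, coord J t z = (b : Cplx V) - z • (j b : Cplx V)) →
    (S.metric s t : ℂ) =
      (1 / 2) * (cform (ϖ (chart0 0)) a (j b) - cform (ϖ (chart0 0)) (j a) b)
  /-- the complex structure with parameter `ζ` is that of the fibre of the normal bundle over `ζ`,
  transported by evaluation at `ζ` -/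
  cplx_eq : ∀ (p : P1) (s : realHolSections J),
    (S.cplx p s : P1 → Cplx V) p = Complex.I • (s : P1 → Cplx V) p
  /-- the holomorphic symplectic form with parameter `ζ` is that of the fibre over `ζ`,
  transported by evaluation at `ζ` -/
  symp_eq : ∀ (p : P1) (s t : realHolSections J),
    S.symp p s t = cform (ϖ p) ((s : P1 → Cplx V) p) ((t : P1 → Cplx V) p)
  /-- the Kähler forms belong to the metric and the complex structures at `ζ = i, -1, 0` -/
  kahler_eq : ∀ (α : Fin 3) (s t : realHolSections J),
    S.kahler α s t = S.metric (S.cplx (basePt α) s) t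

end NormalBundle

/-! ## Tensor fields on a manifold -/

section Manifold

variable {E : Type*} [NormedAddCommGroup E] [NormedSpace ℝ E]
  {M : Type*} [TopologicalSpace M] [ChartedSpace E M]

/-- Fields of `F`-valued bilinear forms on `M`. -/
abbrev BilField (E : Type*) [NormedAddCommGroup E] [NormedSpace ℝ E]
    (M : Type*) [TopologicalSpace M] [ChartedSpace E M]
    (F : Type*) [NormedAddCommGroup F] [NormedSpace ℝ F] : Type _ :=
  ∀ x : M, TangentSpace 𝓘(ℝ, E) x →L[ℝ] TangentSpace 𝓘(ℝ, E) x →L[ℝ] F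

/-- Fields of endomorphisms of the tangent bundle. -/
abbrev EndField (E : Type*) [NormedAddCommGroup E] [NormedSpace ℝ E]
    (M : Type*) [TopologicalSpace M] [ChartedSpace E M] : Type _ :=
  ∀ x : M, TangentSpace 𝓘(ℝ, E) x →L[ℝ] TangentSpace 𝓘(ℝ, E) x

variable [IsManifold 𝓘(ℝ, E) ∞ M]

/-- The vector field `X` is smooth at `x`. -/
def SmoothVecAt (X : ∀ x : M, TangentSpace 𝓘(ℝ, E) x) (x : M) : Prop :=
  ContMDiffAt 𝓘(ℝ, E) (𝓘(ℝ, E).prod 𝓘(ℝ, E)) ∞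
    (fun y => (⟨y, X y⟩ : TangentBundle 𝓘(ℝ, E) M)) x

/-- The underlying algebraic bilinear form of `B` at `x`. -/
def alg {F : Type*} [NormedAddCommGroup F] [NormedSpace ℝ F] (B : BilField E M F) (x : M) :
    TangentSpace 𝓘(ℝ, E) x →ₗ[ℝ] TangentSpace 𝓘(ℝ, E) x →ₗ[ℝ] F :=
  LinearMap.mk₂ ℝ (fun v w => B x v w) (by simp) (by simp) (by simp) (by simp)

section Forms

variable {F : Type*} [NormedAddCommGroup F] [NormedSpace ℝ F]

/-- Smooth fields of bilinear forms. -/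
def SmoothBil (B : BilField E M F) : Prop :=
  ContMDiff 𝓘(ℝ, E) (𝓘(ℝ, E).prod 𝓘(ℝ, E →L[ℝ] E →L[ℝ] F)) ∞
    (fun x => Bundle.TotalSpace.mk' (E →L[ℝ] E →L[ℝ] F)
      (E := fun x : M => TangentSpace 𝓘(ℝ, E) x →L[ℝ] TangentSpace 𝓘(ℝ, E) x →L[ℝ]
        Bundle.Trivial M F x) x (B x))

/-- Smooth 2-forms. -/
def IsTwoForm (B : BilField E M F) : Prop :=
  SmoothBil B ∧ ∀ (x : M) (v : TangentSpace 𝓘(ℝ, E) x), B x v v = 0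

/-- The derivative at `x` of the function `y ↦ B_y(Y_y, Z_y)` in the direction `v`. -/
def dirDeriv (B : BilField E M F) (Y Z : ∀ x : M, TangentSpace 𝓘(ℝ, E) x) (x : M)
    (v : TangentSpace 𝓘(ℝ, E) x) : F :=
  mfderiv 𝓘(ℝ, E) 𝓘(ℝ, F) (fun y => B y (Y y) (Z y)) x v

/-- `dB = 0`, by the invariant formula for the exterior derivative of a 2-form. -/
def IsClosedForm (B : BilField E M F) : Prop :=
  ∀ (x : M) (X Y Z : ∀ x : M, TangentSpace 𝓘(ℝ, E) x),
    SmoothVecAt X x → SmoothVecAt Y x → SmoothVecAt Z x →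
    dirDeriv B Y Z x (X x) - dirDeriv B X Z x (Y x) + dirDeriv B X Y x (Z x)
      - B x (VectorField.mlieBracket 𝓘(ℝ, E) X Y x) (Z x)
      + B x (VectorField.mlieBracket 𝓘(ℝ, E) X Z x) (Y x)
      - B x (VectorField.mlieBracket 𝓘(ℝ, E) Y Z x) (X x) = 0

end Forms

/-- Symplectic forms: closed non-degenerate real 2-forms. -/
structure IsSymplectic (om : BilField E M ℝ) : Prop where
  twoForm : IsTwoForm om
  closed : IsClosedForm om
  nondegenerate : ∀ (x : M) (v : TangentSpace 𝓘(ℝ, E) x), (∀ w, om x v w = 0) → v = 0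

/-- Holomorphic symplectic forms on a real manifold: closed complex 2-forms `Ω` with
`T_ℂ M = ker Ω ⊕ ker (conj Ω)`. -/
structure IsHolomorphicSymplectic (Ω : BilField E M ℂ) : Prop where
  twoForm : IsTwoForm Ω
  closed : IsClosedForm Ω
  isCompl : ∀ x : M, IsCompl (kerForm (alg Ω x)) (kerForm (conjForm (alg Ω x)))

/-- (Integrable) complex structures: smooth `J` with `J² = -1` and vanishing Nijenhuis tensor. -/
structure IsComplexStructure (J : EndField E M) : Prop where
  smooth : ContMDiff 𝓘(ℝ, E) (𝓘(ℝ, E).prod 𝓘(ℝ, E →L[ℝ] E)) ∞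
    (fun x => Bundle.TotalSpace.mk' (E →L[ℝ] E)
      (E := fun x : M => TangentSpace 𝓘(ℝ, E) x →L[ℝ] TangentSpace 𝓘(ℝ, E) x) x (J x))
  sq : ∀ (x : M) (v : TangentSpace 𝓘(ℝ, E) x), J x (J x v) = -v
  integrable : ∀ (x : M) (X Y : ∀ x : M, TangentSpace 𝓘(ℝ, E) x),
    SmoothVecAt X x → SmoothVecAt Y x →
    VectorField.mlieBracket 𝓘(ℝ, E) (fun y => J y (X y)) (fun y => J y (Y y)) x
      - J x (VectorField.mlieBracket 𝓘(ℝ, E) (fun y => J y (X y)) Y x)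
      - J x (VectorField.mlieBracket 𝓘(ℝ, E) X (fun y => J y (Y y)) x)
      - VectorField.mlieBracket 𝓘(ℝ, E) X Y x = 0

/-- Pseudo-hyper-Kähler structures: a pseudo-Riemannian metric `g`, complex structures
`J₁, J₂, J₃` with the unit quaternion relations, symplectic forms `ω₁, ω₂, ω₃` with
`ω_α(v, w) = g(J_α v, w)`, and the induced `ℙ¹`-families of complex structures and
symplectic forms. The indices `1, 2, 3` are the elements `0, 1, 2` of `Fin 3`. -/
structure IsPseudoHyperKahler (g : BilField E M ℝ) (J : Fin 3 → EndField E M)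
    (om : Fin 3 → BilField E M ℝ) : Prop where
  metric_smooth : SmoothBil g
  metric_symm : ∀ (x : M) (v w : TangentSpace 𝓘(ℝ, E) x), g x v w = g x w v
  metric_nondegenerate :
    ∀ (x : M) (v : TangentSpace 𝓘(ℝ, E) x), (∀ w, g x v w = 0) → v = 0
  complex : ∀ α, IsComplexStructure (J α)
  symplectic : ∀ α, IsSymplectic (om α)
  complex_family : ∀ p : P1, IsComplexStructure (fun x => ∑ α, sphereVec p α • J α x)
  symplectic_family : ∀ p : P1, IsSymplectic (fun x => ∑ α, sphereVec p α • om α x)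
  quaternion : ∀ (α : Fin 3) (x : M) (v : TangentSpace 𝓘(ℝ, E) x),
    J α x (J α x v) = -v ∧ J α x (J (α + 1) x v) = J (α + 2) x v ∧
      J (α + 1) x (J α x v) = -J (α + 2) x v
  compatible : ∀ (α : Fin 3) (x : M) (v w : TangentSpace 𝓘(ℝ, E) x),
    om α x v w = g x (J α x v) w ∧ g x v w = om α x v (J α x w)

/-! ## The structure defined by a family of holomorphic symplectic forms -/

/-- Composition of the values of a field of bilinear forms with a real-linear map. -/
def postField {F G : Type*} [NormedAddCommGroup F] [NormedSpace ℝ F]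
    [NormedAddCommGroup G] [NormedSpace ℝ G] (L : F →L[ℝ] G) (B : BilField E M F) :
    BilField E M G :=
  fun x => (ContinuousLinearMap.postcomp (TangentSpace 𝓘(ℝ, E) x) L).comp (B x)

/-- The complex conjugate field. -/
def conjField (B : BilField E M ℂ) : BilField E M ℂ :=
  postField (Complex.conjCLE : ℂ →L[ℝ] ℂ) B

/-- The real part. -/
def reField (B : BilField E M ℂ) : BilField E M ℝ := postField Complex.reCLM B

/-- The imaginary part. -/
def imField (B : BilField E M ℂ) : BilField E M ℝ := postField Complex.imCLM B

/-- The twisted family `ϖ(ζ) = -(i / 2ζ) ω₊ + ω₃ - (i / 2) ζ ω₋`, `ω₋ = conj ω₊`, for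
`ζ ∈ ℂ^×`, completed by `ω₊` at `ζ = 0` and `ω₋` at `ζ = ∞`. -/
def varpi (ωp : BilField E M ℂ) (ω₃ : BilField E M ℝ) (p : P1) : BilField E M ℂ :=
  OnePoint.elim p (conjField ωp) (fun z => if z = 0 then ωp else
    fun x => (-(Complex.I / (2 * z))) • ωp x + postField Complex.ofRealCLM ω₃ x
      - (Complex.I / 2 * z) • conjField ωp x)

variable [FiniteDimensional ℝ E]

instance (x : M) : FiniteDimensional ℝ (TangentSpace 𝓘(ℝ, E) x) :=
  inferInstanceAs (FiniteDimensional ℝ E)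

instance (x : M) : T2Space (TangentSpace 𝓘(ℝ, E) x) :=
  inferInstanceAs (T2Space E)

/-- The complex structure `J^(ζ)` defined by the holomorphic symplectic form `ϖ(ζ)`. -/
def familyJ (ωp : BilField E M ℂ) (ω₃ : BilField E M ℝ) (p : P1) : EndField E M :=
  fun x => LinearMap.toContinuousLinearMap (assocJ (alg (varpi ωp ω₃ p) x))

/-- The complex structures `J₁ = J^(i)`, `J₂ = J^(-1)`, `J₃ = J^(0)`. -/
def tripleJ (ωp : BilField E M ℂ) (ω₃ : BilField E M ℝ) (α : Fin 3) : EndField E M :=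
  familyJ ωp ω₃ (basePt α)

/-- The forms `ω₁, ω₂, ω₃`, where `ω₊ = ω₁ + i ω₂`. -/
def tripleForm (ωp : BilField E M ℂ) (ω₃ : BilField E M ℝ) : Fin 3 → BilField E M ℝ :=
  ![reField ωp, imField ωp, ω₃]

/-- The bilinear form `½ (1 ⊗ J₁' - J₁' ⊗ 1) ω₊`, i.e. `½ (ω₊(v, J₁ w) - ω₊(J₁ v, w))`. -/
def twistBil (ωp : BilField E M ℂ) (ω₃ : BilField E M ℝ) : BilField E M ℂ :=
  fun x => (1 / 2 : ℝ) •
    ((ContinuousLinearMap.precomp ℂ (tripleJ ωp ω₃ 0 x)).comp (ωp x)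
      - (ωp x).comp (tripleJ ωp ω₃ 0 x))

/-- The metric, as a real-valued form. -/
def twistMetric (ωp : BilField E M ℂ) (ω₃ : BilField E M ℝ) : BilField E M ℝ :=
  reField (twistBil ωp ω₃)

/-- The family of complex structures on the tangent space at `x`. -/
def famAt (ωp : BilField E M ℂ) (ω₃ : BilField E M ℝ) (x : M) (p : P1) :
    TangentSpace 𝓘(ℝ, E) x →ₗ[ℝ] TangentSpace 𝓘(ℝ, E) x :=
  (familyJ ωp ω₃ p x).toLinearMap

end Manifold

end HKTwistor

end

open HKTwistor

noncomputable section

namespace HKTwistor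

/-! ### Complexification, conjugation and types -/

section Complexification

variable {V : Type*} [AddCommGroup V] [Module ℝ V]

/-! Apart from smoothness and integrability, everything is linear algebra at one point. A complex
2-form `B` with `V_ℂ = ker B ⊕ ker B̄` determines `J` by `B(Jv, w) = i B(v, w)`, and this property
characterises `J` (`form_assocJ`, `eq_assocJ`).

Put `I = J₃` and define `K` by `ω₃(v, w) = Re ω₊(Kv, w)`, which is possible because `Re ω₊` is
nondegenerate. Read through `Re ω₊`, the form `2iζ ϖ(ζ)` is the operator `P + iζK + ζ²(1 - P)`,
where `P` projects to type `(1,0)` for `I`. The hypothesis says that its kernel has half the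
dimension for every `ζ ≠ 0`. Letting `ζ → 0` shows that `K` exchanges the types, and then the kernel
equation at a single `ζ` gives `K² = -1` (`quaternionic_of_twistForm`). So `I` and `K` generate the
quaternions. The combination `c₁KI + c₂K + c₃I` acts as `i` in `ϖ(ζ)`, hence equals `J^(ζ)`
(`exists_pointJ_eq`); in particular `J₁ = KI` and `J₂ = K`. The metric is `-ω₁(J₁v, w)`.

Smoothness holds because the `J_α` are quotients of smooth nondegenerate forms. Integrability holds
because `J^(ζ)` is defined by a closed form: contracting its Nijenhuis tensor with `ϖ(ζ)` gives a
combination of values of `dϖ(ζ)` (`IsClosedTwoForm.isComplexStructure`).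

On a twistor line, the `(1,0)`-parts of a constant vector form a holomorphic section, since
`(1,0)`-covectors do not see the `(0,1)`-part. The vectors `J₁a - ζa`, with `a` of type `(1,0)` over
`0`, have type `(0,1)` over `ζ`; hence the sections of `a` and `J₁a` differ by the factor `ζ`, and
the bundle is a sum of copies of `𝒪(1)`. By Liouville, a section that vanishes at `0` and `∞` is
zero (`eq_zero_of_vanishing`). A real section is therefore determined by its value at `0`, so that
`Φ` is an isomorphism, through which the remaining structure is transported (`exists_isHKLR`). -/

theorem cext_incl (A : V →ₗ[ℝ] V) (v : V) : cext A (incl v) = incl (A v) := by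
  simp [cext, incl]

theorem cconj_incl (v : V) : cconj (incl v) = incl v := by
  simp [cconj, incl]

theorem cconj_smul (c : ℂ) (x : Cplx V) : cconj (c • x) = (starRingEnd ℂ c) • cconj x := by
  induction x using TensorProduct.induction_on with
  | zero => simp
  | tmul a v => simp [cconj, TensorProduct.smul_tmul']
  | add x y hx hy => rw [smul_add, map_add, hx, hy, map_add, smul_add]

theorem cconj_cconj (x : Cplx V) : cconj (cconj x) = x := by
  induction x using TensorProduct.induction_on with
  | zero => simp
  | tmul a v => simp [cconj]
  | add x y hx hy => rw [map_add, map_add, hx, hy]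

theorem cform_incl (B : V →ₗ[ℝ] V →ₗ[ℝ] ℂ) (v w : V) : cform B (incl v) (incl w) = B v w := by
  simp [cform, incl]

theorem rePart_incl (v : V) : rePart (incl v) = v := by
  simp [rePart, incl]

theorem incl_injective : Function.Injective (incl : V →ₗ[ℝ] Cplx V) :=
  Function.LeftInverse.injective rePart_incl

/-- Every vector of the complexification has a real and an imaginary part. -/
theorem exists_eq_incl_add (x : Cplx V) : ∃ v w : V, x = incl v + Complex.I • incl w := by
  induction x using TensorProduct.induction_on with
  | zero => exact ⟨0, 0, by simp⟩
  | tmul a v =>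
    refine ⟨a.re • v, a.im • v, ?_⟩
    simp only [incl, TensorProduct.mk_apply, TensorProduct.smul_tmul', TensorProduct.tmul_smul]
    rw [← TensorProduct.add_tmul]
    congr 1
    apply Complex.ext <;> simp
  | add x y hx hy =>
    obtain ⟨v, w, rfl⟩ := hx
    obtain ⟨v', w', rfl⟩ := hy
    exact ⟨v + v', w + w', by simp only [map_add, smul_add]; abel⟩

theorem cconj_eq (v w : V) :
    cconj (incl v + Complex.I • incl w) = incl v - Complex.I • incl w := by
  rw [map_add, cconj_smul, cconj_incl, cconj_incl, Complex.conj_I, neg_smul, sub_eq_add_neg]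

theorem real_smul_eq (c : ℝ) (x : Cplx V) : c • x = (c : ℂ) • x := (Complex.coe_smul c x).symm

/-- Complex-linear maps on the complexification that agree on real vectors are equal. -/
theorem clinear_ext {N : Type*} [AddCommGroup N] [Module ℂ N] {f g : Cplx V →ₗ[ℂ] N}
    (h : ∀ v, f (incl v) = g (incl v)) : f = g := by
  refine LinearMap.ext fun x => ?_
  obtain ⟨v, w, rfl⟩ := exists_eq_incl_add x
  simp only [map_add, map_smul, h]

theorem clinear_ext₂ {N : Type*} [AddCommGroup N] [Module ℂ N]
    {f g : Cplx V →ₗ[ℂ] Cplx V →ₗ[ℂ] N}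
    (h : ∀ v w, f (incl v) (incl w) = g (incl v) (incl w)) : f = g :=
  clinear_ext fun v => clinear_ext fun w => h v w

theorem cext_comp_apply (A A' : V →ₗ[ℝ] V) (x : Cplx V) :
    cext (A ∘ₗ A') x = cext A (cext A' x) := by
  obtain ⟨v, w, rfl⟩ := exists_eq_incl_add x
  simp only [map_add, map_smul, cext_incl, LinearMap.comp_apply]

theorem cext_add_apply (A A' : V →ₗ[ℝ] V) (x : Cplx V) :
    cext (A + A') x = cext A x + cext A' x := by
  simp [cext, LinearMap.baseChange_add]

theorem cext_smul_apply (c : ℝ) (A : V →ₗ[ℝ] V) (x : Cplx V) :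
    cext (c • A) x = (c : ℂ) • cext A x := by
  rw [← real_smul_eq]
  simp [cext, LinearMap.baseChange_smul]

theorem cext_neg_apply (A : V →ₗ[ℝ] V) (x : Cplx V) : cext (-A) x = -cext A x := by
  simp [cext]

theorem cext_cconj (A : V →ₗ[ℝ] V) (x : Cplx V) : cext A (cconj x) = cconj (cext A x) := by
  obtain ⟨v, w, rfl⟩ := exists_eq_incl_add x
  rw [cconj_eq, map_add, map_smul, cext_incl, cext_incl, cconj_eq, map_sub, map_smul, cext_incl,
    cext_incl]

theorem cext_sq {A : V →ₗ[ℝ] V} (h : ∀ v, A (A v) = -v) (x : Cplx V) :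
    cext A (cext A x) = -x := by
  obtain ⟨v, w, rfl⟩ := exists_eq_incl_add x
  simp only [map_add, map_smul, cext_incl, h, map_neg, smul_neg, neg_add]

theorem cext_ext {A A' : V →ₗ[ℝ] V} (h : ∀ v, A v = A' v) (x : Cplx V) :
    cext A x = cext A' x := by
  rw [LinearMap.ext h]

theorem incl_rePart (x : Cplx V) : incl (rePart x) = (2⁻¹ : ℂ) • (x + cconj x) := by
  obtain ⟨v, w, rfl⟩ := exists_eq_incl_add x
  have h : rePart (Complex.I • incl w) = 0 := by
    simp [rePart, incl, TensorProduct.smul_tmul']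
  rw [cconj_eq, map_add, h, rePart_incl, add_zero]
  module

theorem exists_incl_of_cconj {x : Cplx V} (h : cconj x = x) : ∃ v, x = incl v :=
  ⟨rePart x, by rw [incl_rePart, h]; module⟩

theorem cform_conjForm (B : V →ₗ[ℝ] V →ₗ[ℝ] ℂ) (x y : Cplx V) :
    cform (conjForm B) (cconj x) (cconj y) = starRingEnd ℂ (cform B x y) := by
  obtain ⟨v, w, rfl⟩ := exists_eq_incl_add x
  obtain ⟨v', w', rfl⟩ := exists_eq_incl_add y
  rw [cconj_eq, cconj_eq]
  simp only [map_add, map_sub, LinearMap.add_apply, LinearMap.sub_apply, map_smul,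
    LinearMap.smul_apply, cform_incl, conjForm, LinearMap.compr₂_apply, smul_eq_mul, map_mul,
    Complex.conj_I, AlgEquiv.toLinearMap_apply, Complex.conjAe_coe]
  ring

theorem conjForm_conjForm (B : V →ₗ[ℝ] V →ₗ[ℝ] ℂ) : conjForm (conjForm B) = B := by
  ext v w
  simp [conjForm]

theorem conjForm_apply (B : V →ₗ[ℝ] V →ₗ[ℝ] ℂ) (v w : V) :
    conjForm B v w = starRingEnd ℂ (B v w) := by
  simp [conjForm]

theorem mem_kerForm {B : V →ₗ[ℝ] V →ₗ[ℝ] ℂ} {x : Cplx V} :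
    x ∈ kerForm B ↔ ∀ w, cform B x (incl w) = 0 := by
  rw [kerForm, LinearMap.mem_ker]
  exact ⟨fun h w => by rw [h]; rfl, fun h => clinear_ext fun w => by simp [h]⟩

theorem mem_kerForm_conjForm {B : V →ₗ[ℝ] V →ₗ[ℝ] ℂ} {x : Cplx V} :
    x ∈ kerForm (conjForm B) ↔ cconj x ∈ kerForm B := by
  rw [mem_kerForm, mem_kerForm]
  refine forall_congr' fun w => ?_
  rw [← map_eq_zero (starRingEnd ℂ), ← cform_conjForm, conjForm_conjForm, cconj_incl]

theorem incl_mem_kerForm {B : V →ₗ[ℝ] V →ₗ[ℝ] ℂ} {v : V} :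
    incl v ∈ kerForm B ↔ ∀ w, B v w = 0 := by
  simp only [mem_kerForm, cform_incl]

/-- A real vector is its own conjugate, so it lies in both kernels as soon as it lies in one. -/
theorem eq_zero_of_isCompl {B : V →ₗ[ℝ] V →ₗ[ℝ] ℂ}
    (hB : IsCompl (kerForm B) (kerForm (conjForm B))) {v : V} (h : ∀ w, B v w = 0) : v = 0 := by
  have h1 : incl v ∈ kerForm B := incl_mem_kerForm.2 h
  have h2 : incl v ∈ kerForm (conjForm B) := by rwa [mem_kerForm_conjForm, cconj_incl]
  exact incl_injective ((Submodule.disjoint_def.1 hB.disjoint _ h1 h2).trans (map_zero _).symm)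

theorem mem_T10 {J : V →ₗ[ℝ] V} {x : Cplx V} : x ∈ T10 J ↔ cext J x = Complex.I • x :=
  Module.End.mem_eigenspace_iff

theorem mem_T01 {J : V →ₗ[ℝ] V} {x : Cplx V} : x ∈ T01 J ↔ cext J x = -(Complex.I • x) := by
  rw [T01, Module.End.mem_eigenspace_iff, neg_smul]

theorem cconj_mem_T10 {J : V →ₗ[ℝ] V} {x : Cplx V} : cconj x ∈ T10 J ↔ x ∈ T01 J := by
  rw [mem_T10, mem_T01, cext_cconj]
  constructor
  · intro h
    rw [← cconj_cconj (cext J x), h, cconj_smul, cconj_cconj, Complex.conj_I, neg_smul]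
  · intro h
    rw [h, map_neg, cconj_smul, Complex.conj_I, neg_smul, neg_neg]

theorem cconj_mem_T01 {J : V →ₗ[ℝ] V} {x : Cplx V} : cconj x ∈ T01 J ↔ x ∈ T10 J := by
  rw [← cconj_mem_T10, cconj_cconj]

theorem proj10_apply (J : V →ₗ[ℝ] V) (x : Cplx V) :
    proj10 J x = (2⁻¹ : ℂ) • (x - Complex.I • cext J x) := rfl

theorem proj10_of_mem_T10 {J : V →ₗ[ℝ] V} {x : Cplx V} (h : x ∈ T10 J) : proj10 J x = x := by
  rw [proj10_apply, mem_T10.1 h, smul_smul, Complex.I_mul_I]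
  module

theorem proj10_of_mem_T01 {J : V →ₗ[ℝ] V} {x : Cplx V} (h : x ∈ T01 J) : proj10 J x = 0 := by
  rw [proj10_apply, mem_T01.1 h, smul_neg, smul_smul, Complex.I_mul_I]
  module

theorem proj10_mem {J : V →ₗ[ℝ] V} (hJ : ∀ v, J (J v) = -v) (x : Cplx V) :
    proj10 J x ∈ T10 J := by
  rw [mem_T10, proj10_apply, map_smul, map_sub, map_smul, cext_sq hJ, smul_comm Complex.I (2⁻¹ : ℂ),
    smul_sub Complex.I, smul_smul Complex.I, Complex.I_mul_I]
  module

theorem sub_proj10_mem {J : V →ₗ[ℝ] V} (hJ : ∀ v, J (J v) = -v) (x : Cplx V) :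
    x - proj10 J x ∈ T01 J := by
  have h : x - proj10 J x = (2⁻¹ : ℂ) • (x + Complex.I • cext J x) := by
    rw [proj10_apply]
    module
  rw [h, mem_T01, map_smul, map_add, map_smul, cext_sq hJ, smul_comm Complex.I (2⁻¹ : ℂ),
    smul_add Complex.I, smul_smul Complex.I, Complex.I_mul_I]
  module

theorem T10_inf_T01 {J : V →ₗ[ℝ] V} {x : Cplx V} (h : x ∈ T10 J) (h' : x ∈ T01 J) : x = 0 := by
  rw [← proj10_of_mem_T10 h, proj10_of_mem_T01 h']

theorem proj10_eq_zero_iff {J : V →ₗ[ℝ] V} (hJ : ∀ v, J (J v) = -v) {x : Cplx V} :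
    proj10 J x = 0 ↔ x ∈ T01 J :=
  ⟨fun h => by simpa [h] using sub_proj10_mem hJ x, proj10_of_mem_T01⟩

theorem proj10_incl_add_cconj {J : V →ₗ[ℝ] V} (v : V) :
    proj10 J (incl v) + cconj (proj10 J (incl v)) = incl v := by
  rw [proj10_apply, cconj_smul, map_sub, cconj_smul, ← cext_cconj, cconj_incl, Complex.conj_I]
  simp only [map_inv₀, map_ofNat]
  module

theorem proj10_incl_injective {J : V →ₗ[ℝ] V} {v w : V}
    (h : proj10 J (incl v) = proj10 J (incl w)) : v = w := by
  apply incl_injective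
  rw [← proj10_incl_add_cconj (J := J) v, h, proj10_incl_add_cconj]

theorem mem_coT10 {J : V →ₗ[ℝ] V} {φ : Module.Dual ℂ (Cplx V)} :
    φ ∈ coT10 J ↔ ∀ x, φ (cext J x) = Complex.I * φ x := by
  rw [coT10, Module.End.mem_eigenspace_iff, LinearMap.ext_iff]
  rfl

theorem mem_coT10_iff {J : V →ₗ[ℝ] V} (hJ : ∀ v, J (J v) = -v) {φ : Module.Dual ℂ (Cplx V)} :
    φ ∈ coT10 J ↔ ∀ x ∈ T01 J, φ x = 0 := by
  rw [mem_coT10]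
  constructor
  · intro h x hx
    have := h x
    rw [mem_T01.1 hx, map_neg, map_smul, smul_eq_mul] at this
    have h2 : 2 * Complex.I * φ x = 0 := by linear_combination -this
    simpa using h2
  · intro h x
    have h1 := h _ (sub_proj10_mem hJ x)
    rw [proj10_apply, map_sub, map_smul, map_sub, map_smul, smul_eq_mul, smul_eq_mul] at h1
    linear_combination (-2 * Complex.I) * h1 + (φ (cext J x)) * Complex.I_mul_I

theorem coT10_proj10 {J : V →ₗ[ℝ] V} (hJ : ∀ v, J (J v) = -v) {φ : Module.Dual ℂ (Cplx V)}
    (hφ : φ ∈ coT10 J) (x : Cplx V) : φ (proj10 J x) = φ x := by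
  have := (mem_coT10_iff hJ).1 hφ _ (sub_proj10_mem hJ x)
  rw [map_sub, sub_eq_zero] at this
  exact this.symm

theorem comp_proj10_mem_coT10 {J : V →ₗ[ℝ] V} (hJ : ∀ v, J (J v) = -v)
    (φ : Module.Dual ℂ (Cplx V)) : φ ∘ₗ proj10 J ∈ coT10 J :=
  (mem_coT10_iff hJ).2 fun x hx => by simp [proj10_of_mem_T01 hx]

theorem eq_zero_of_forall_dual {x : Cplx V} (h : ∀ φ : Module.Dual ℂ (Cplx V), φ x = 0) : x = 0 :=
  (Module.forall_dual_apply_eq_zero_iff ℂ x).1 h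

/-- Two subspaces exchanged by conjugation have the same dimension. -/
theorem finrank_eq_of_cconj {p q : Submodule ℂ (Cplx V)} (h : ∀ x, x ∈ q ↔ cconj x ∈ p) :
    Module.finrank ℂ p = Module.finrank ℂ q := by
  have e : p ≃ₗ[ℝ] q :=
    { toFun := fun x => ⟨cconj x, (h _).2 (by rw [cconj_cconj]; exact x.2)⟩
      invFun := fun x => ⟨cconj x, (h _).1 x.2⟩
      map_add' := fun x y => Subtype.ext (map_add _ _ _)
      map_smul' := fun c x => Subtype.ext (map_smul cconj c (x : Cplx V))
      left_inv := fun x => Subtype.ext (cconj_cconj _)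
      right_inv := fun x => Subtype.ext (cconj_cconj _) }
  have := e.finrank_eq
  rw [← Module.finrank_mul_finrank ℝ ℂ p, ← Module.finrank_mul_finrank ℝ ℂ q] at this
  exact Nat.eq_of_mul_eq_mul_left Module.finrank_pos this

/-- Conjugation exchanges the summands, so each has half the dimension. This is the source of the
constant rank of the family `ϖ(ζ)`. -/
theorem two_mul_finrank_of_isCompl [FiniteDimensional ℝ V] {p q : Submodule ℂ (Cplx V)}
    (hpq : IsCompl p q) (h : ∀ x, x ∈ q ↔ cconj x ∈ p) :
    2 * Module.finrank ℂ p = Module.finrank ℝ V := by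
  have h1 := Submodule.finrank_add_eq_of_isCompl hpq
  rw [← finrank_eq_of_cconj h, Module.finrank_baseChange] at h1
  omega

theorem isCompl_T10_T01 {J : V →ₗ[ℝ] V} (hJ : ∀ v, J (J v) = -v) : IsCompl (T10 J) (T01 J) := by
  refine ⟨Submodule.disjoint_def.2 fun x => T10_inf_T01, codisjoint_iff.2 ?_⟩
  refine Submodule.eq_top_iff'.2 fun x => ?_
  exact Submodule.mem_sup.2 ⟨_, proj10_mem hJ x, _, sub_proj10_mem hJ x, by abel⟩

theorem two_mul_finrank_T10 [FiniteDimensional ℝ V] {J : V →ₗ[ℝ] V} (hJ : ∀ v, J (J v) = -v) :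
    2 * Module.finrank ℂ (T10 J) = Module.finrank ℝ V :=
  two_mul_finrank_of_isCompl (isCompl_T10_T01 hJ) fun _ => cconj_mem_T10.symm

end Complexification

/-! ### The complex structure defined by a 2-form -/

section AssociatedComplexStructure

variable {V : Type*} [AddCommGroup V] [Module ℝ V] {B : V →ₗ[ℝ] V →ₗ[ℝ] ℂ}

/-- `J` acts by `i` in the first argument of the form that defines it. -/
theorem form_assocJ (hB : IsCompl (kerForm B) (kerForm (conjForm B))) (v w : V) :
    B (assocJ B v) w = Complex.I * B v w := by
  obtain ⟨p, hp, q, hq, hpq⟩ := Submodule.mem_sup.1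
    (show incl v ∈ kerForm (conjForm B) ⊔ kerForm B by rw [hB.symm.sup_eq_top]; trivial)
  -- A real vector is fixed by conjugation, which exchanges the two kernels; its components are
  -- therefore conjugate to each other.
  have hcp : cconj p = q := by
    have h1 : p + q = cconj p + cconj q := by
      rw [← map_add, hpq, cconj_incl]
    have h2 : cconj p - q = p - cconj q := by
      rw [sub_eq_sub_iff_add_eq_add, ← h1, add_comm]
    have h3 : cconj p - q ∈ kerForm B := sub_mem (mem_kerForm_conjForm.1 hp) hq
    have h4 : cconj p - q ∈ kerForm (conjForm B) := by
      rw [h2]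
      exact sub_mem hp (by rw [mem_kerForm_conjForm, cconj_cconj]; exact hq)
    exact sub_eq_zero.1 (Submodule.disjoint_def.1 hB.disjoint _ h3 h4)
  have hJ : assocJ B v = rePart (Complex.I • p - Complex.I • q) := by
    rw [assocJ, dif_pos hB.symm]
    have e1 : (((kerForm (conjForm B)).projectionOnto _ hB.symm (incl v) : kerForm (conjForm B)) :
        Cplx V) = p := by
      rw [← hpq, map_add, Submodule.projectionOnto_apply_of_mem_left hB.symm hp,
        Submodule.projectionOnto_apply_of_mem_right hB.symm hq, add_zero]
    have e2 : (((kerForm B).projectionOnto _ hB.symm.symm (incl v) : kerForm B) :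
        Cplx V) = q := by
      rw [← hpq, map_add, Submodule.projectionOnto_apply_of_mem_left hB hq,
        Submodule.projectionOnto_apply_of_mem_right hB hp, zero_add]
    simp [e1, e2]
  -- As `q = p̄`, the vector `ip - iq` is already real, and taking the real part loses nothing.
  have hi : incl (assocJ B v) = Complex.I • p - Complex.I • q := by
    rw [hJ, incl_rePart, map_sub, cconj_smul, cconj_smul, ← hcp, cconj_cconj, Complex.conj_I]
    module
  have hq0 : cform B q = 0 := hq
  rw [← cform_incl, ← cform_incl B v, hi, ← hpq]
  simp [hq0]

/-- Both operators act as `i` in the first argument, and `B` is nondegenerate on real vectors. This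
is how explicit formulas for `J^(ζ)` are recognised. -/
theorem eq_assocJ (hB : IsCompl (kerForm B) (kerForm (conjForm B))) {L : V →ₗ[ℝ] V}
    (hL : ∀ v w, B (L v) w = Complex.I * B v w) : L = assocJ B := by
  ext v
  rw [← sub_eq_zero]
  refine eq_zero_of_isCompl hB fun w => ?_
  rw [map_sub, LinearMap.sub_apply, hL, form_assocJ hB, sub_self]

theorem assocJ_sq (hB : IsCompl (kerForm B) (kerForm (conjForm B))) (v : V) :
    assocJ B (assocJ B v) = -v := by
  rw [← sub_eq_zero]
  refine eq_zero_of_isCompl hB fun w => ?_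
  rw [map_sub, LinearMap.sub_apply, form_assocJ hB, form_assocJ hB, ← mul_assoc, Complex.I_mul_I]
  simp

theorem cform_cext_assocJ (hB : IsCompl (kerForm B) (kerForm (conjForm B))) (x y : Cplx V) :
    cform B (cext (assocJ B) x) y = Complex.I * cform B x y := by
  have h : (cform B) ∘ₗ cext (assocJ B) = Complex.I • cform B :=
    clinear_ext₂ fun v w => by
      simp only [LinearMap.comp_apply, cext_incl, cform_incl, form_assocJ hB, LinearMap.smul_apply,
        smul_eq_mul]
  exact LinearMap.congr_fun (LinearMap.congr_fun h x) y

/-- For `x` of type `(0,1)`, `B(Jx, w)` is both `-iB(x, w)` and `iB(x, w)`. Conversely, the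
`(1,0)`-part of a vector in the kernel lies in both kernels, hence vanishes. -/
theorem T01_assocJ (hB : IsCompl (kerForm B) (kerForm (conjForm B))) :
    T01 (assocJ B) = kerForm B := by
  have key : ∀ x, x ∈ T01 (assocJ B) → x ∈ kerForm B := by
    intro x hx
    rw [mem_kerForm]
    intro w
    have h := cform_cext_assocJ hB x (incl w)
    rw [mem_T01.1 hx, map_neg, map_smul, LinearMap.neg_apply, LinearMap.smul_apply,
      smul_eq_mul] at h
    have h2 : 2 * Complex.I * cform B x (incl w) = 0 := by linear_combination -h
    simpa using h2
  refine le_antisymm key fun x hx => ?_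
  have h1 : x - proj10 (assocJ B) x ∈ kerForm B := key _ (sub_proj10_mem (assocJ_sq hB) x)
  have h2 : proj10 (assocJ B) x ∈ kerForm B := by
    have := sub_mem hx h1
    rwa [sub_sub_cancel] at this
  have h3 : proj10 (assocJ B) x ∈ kerForm (conjForm B) := by
    rw [mem_kerForm_conjForm]
    exact key _ (cconj_mem_T01.2 (proj10_mem (assocJ_sq hB) x))
  rw [← proj10_eq_zero_iff (assocJ_sq hB)]
  exact Submodule.disjoint_def.1 hB.disjoint _ h2 h3

theorem T10_assocJ (hB : IsCompl (kerForm B) (kerForm (conjForm B))) :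
    T10 (assocJ B) = kerForm (conjForm B) := by
  ext x
  rw [← cconj_mem_T01, mem_kerForm_conjForm, T01_assocJ hB]

end AssociatedComplexStructure

/-! ### A limit argument at the origin -/

section ConstantRank

open Filter Topology

/-- If `(F + z G) Q(z)⁻¹ u = 0` for all small `z ≠ 0`, where `Q(z) = 1 + z A₁ + z² A₂`, then
`F u = 0`. -/
theorem apply_eq_zero_of_punctured {W : Type*} [AddCommGroup W] [Module ℂ W]
    [FiniteDimensional ℂ W] (A₁ A₂ F G : W →ₗ[ℂ] W) (u : W)
    (h : ∀ z : ℂ, z ≠ 0 → Function.Injective (LinearMap.id + z • A₁ + z ^ 2 • A₂ : W →ₗ[ℂ] W) →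
      ∃ y, (LinearMap.id + z • A₁ + z ^ 2 • A₂ : W →ₗ[ℂ] W) y = u ∧ (F + z • G) y = 0) :
    F u = 0 ∧ ∃ z : ℂ, z ≠ 0 ∧ Function.Injective (LinearMap.id + z • A₁ + z ^ 2 • A₂ : W →ₗ[ℂ] W) := by
  classical
  let b := Module.finBasis ℂ W
  let T : (W →ₗ[ℂ] W) ≃ₗ[ℂ] _ := LinearMap.toMatrix b b
  let Q : ℂ → W →ₗ[ℂ] W := fun z => LinearMap.id + z • A₁ + z ^ 2 • A₂
  have hQ : ∀ z, T (Q z) = 1 + z • T A₁ + z ^ 2 • T A₂ := fun z => by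
    simp only [Q, map_add, map_smul, T, LinearMap.toMatrix_id]
  have hcont : Continuous fun z => T (Q z) := by
    simp only [hQ]
    fun_prop
  have hdet : ∀ᶠ z in 𝓝 (0 : ℂ), (T (Q z)).det ≠ 0 := by
    refine (Continuous.matrix_det hcont).continuousAt.eventually_ne ?_
    simp [hQ]
  have hinj : ∀ z, (T (Q z)).det ≠ 0 → Function.Injective (Q z) := by
    intro z hz
    rw [LinearMap.det_toMatrix] at hz
    exact (LinearMap.equivOfDetNeZero (Q z) hz).injective
  have hev : ∀ᶠ z in 𝓝[≠] (0 : ℂ), (T (Q z)).det ≠ 0 ∧ z ≠ 0 :=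
    (hdet.filter_mono nhdsWithin_le_nhds).and self_mem_nhdsWithin
  refine ⟨?_, ?_⟩
  -- The adjugate stands in for `Q(z)⁻¹`: it differs from it by the factor `det Q(z)` but is
  -- continuous at `0` without further argument.
  · let f : ℂ → _ := fun z =>
      (T F + z • T G).mulVec ((T (Q z)).adjugate.mulVec (b.repr u))
    have hf : Continuous f := by
      refine Continuous.matrix_mulVec (by fun_prop) ?_
      exact Continuous.matrix_mulVec (Continuous.matrix_adjugate hcont) continuous_const
    have hz : ∀ᶠ z in 𝓝[≠] (0 : ℂ), f z = 0 := by
      filter_upwards [hev] with z hz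
      obtain ⟨y, hy1, hy2⟩ := h z hz.2 (hinj z hz.1)
      have e1 : (b.repr u : _ → ℂ) = (T (Q z)).mulVec (b.repr y) := by
        rw [LinearMap.toMatrix_mulVec_repr, ← hy1]
      have e2 : (T F + z • T G).mulVec (b.repr y) = 0 := by
        rw [← map_smul, ← map_add, LinearMap.toMatrix_mulVec_repr, hy2]
        simp
      simp only [f]
      rw [e1, Matrix.mulVec_mulVec (b.repr y), Matrix.adjugate_mul, Matrix.smul_mulVec,
        Matrix.one_mulVec, Matrix.mulVec_smul, e2, smul_zero]
    -- By continuity `f` also vanishes at `0`, where `Q(0) = 1` and `f(0) = F u`.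
    have h0 : f 0 = 0 :=
      tendsto_nhds_unique (hf.continuousAt.tendsto.mono_left nhdsWithin_le_nhds)
        (tendsto_const_nhds.congr' (hz.mono fun z hz => hz.symm))
    simp only [f, hQ] at h0
    simp only [zero_smul, add_zero, ne_eq, OfNat.ofNat_ne_zero, not_false_eq_true, zero_pow,
      Matrix.adjugate_one, Matrix.one_mulVec, LinearMap.toMatrix_mulVec_repr, T] at h0
    exact b.repr.injective (by ext i; simpa using congrFun h0 i)
  · obtain ⟨z, hz⟩ := hev.exists
    exact ⟨z, hz.2, hinj z hz.1⟩

end ConstantRank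

/-! ### The quaternion relations from the twisted family -/

section TwistedFamily

variable {V : Type*} [AddCommGroup V] [Module ℝ V]

/-- The member `-(i / 2z) B + W - (i / 2) z conj B` of the twisted family. -/
def twistForm (B : V →ₗ[ℝ] V →ₗ[ℝ] ℂ) (W : V →ₗ[ℝ] V →ₗ[ℝ] ℝ) (z : ℂ) : V →ₗ[ℝ] V →ₗ[ℝ] ℂ :=
  (-(Complex.I / (2 * z))) • B + W.compr₂ Complex.ofRealCLM.toLinearMap
    - (Complex.I / 2 * z) • conjForm B

theorem twistForm_apply (B : V →ₗ[ℝ] V →ₗ[ℝ] ℂ) (W : V →ₗ[ℝ] V →ₗ[ℝ] ℝ) (z : ℂ) (v w : V) :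
    twistForm B W z v w = -(Complex.I / (2 * z)) * B v w + W v w
      - Complex.I / 2 * z * starRingEnd ℂ (B v w) := by
  simp [twistForm, conjForm_apply]

/-- The real part of the form `B`. -/
def reForm (B : V →ₗ[ℝ] V →ₗ[ℝ] ℂ) : V →ₗ[ℝ] V →ₗ[ℝ] ℝ := B.compr₂ Complex.reLm

theorem reForm_apply (B : V →ₗ[ℝ] V →ₗ[ℝ] ℂ) (v w : V) : reForm B v w = (B v w).re := rfl

variable {B : V →ₗ[ℝ] V →ₗ[ℝ] ℂ} {W : V →ₗ[ℝ] V →ₗ[ℝ] ℝ}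

/-- Replacing `w` by `Jw` multiplies `B(v, w)` by `i`, so the real part controls the imaginary part
as well. -/
theorem eq_zero_of_reForm (hB : IsCompl (kerForm B) (kerForm (conjForm B)))
    (hskew : ∀ v w, B v w = -B w v) {v : V} (h : ∀ w, (B v w).re = 0) : v = 0 := by
  refine eq_zero_of_isCompl hB fun w => Complex.ext (h w) ?_
  have h1 := h (assocJ B w)
  rw [hskew, form_assocJ hB, hskew w] at h1
  simpa using h1

theorem exists_reForm_eq [FiniteDimensional ℝ V] (hB : IsCompl (kerForm B) (kerForm (conjForm B)))
    (hskew : ∀ v w, B v w = -B w v) (W : V →ₗ[ℝ] V →ₗ[ℝ] ℝ) :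
    ∃ K : V →ₗ[ℝ] V, ∀ v w, W v w = (B (K v) w).re := by
  have hinj : Function.Injective (reForm B) := by
    rw [injective_iff_map_eq_zero]
    exact fun v hv => eq_zero_of_reForm hB hskew fun w => LinearMap.congr_fun hv w
  let e : V ≃ₗ[ℝ] (V →ₗ[ℝ] ℝ) :=
    LinearEquiv.ofInjectiveOfFinrankEq (reForm B) hinj Subspace.dual_finrank_eq.symm
  have he : ∀ v, e v = reForm B v := fun v => rfl
  refine ⟨e.symm.toLinearMap ∘ₗ W, fun v w => ?_⟩
  rw [← reForm_apply, LinearMap.comp_apply, ← he]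
  simp

/-- The operator `2 i z ϖ(z)`, read through the real part of `B`. -/
def twistOp (I K : V →ₗ[ℝ] V) (z : ℂ) : Cplx V →ₗ[ℂ] Cplx V :=
  proj10 I + (Complex.I * z) • cext K + z ^ 2 • (LinearMap.id - proj10 I)

theorem twistOp_eq_zero (hB : IsCompl (kerForm B) (kerForm (conjForm B)))
    (hskew : ∀ v w, B v w = -B w v) {K : V →ₗ[ℝ] V} (hK : ∀ v w, W v w = (B (K v) w).re)
    {z : ℂ} (hz : z ≠ 0) {x : Cplx V} (hx : x ∈ kerForm (twistForm B W z)) :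
    twistOp (assocJ B) K z x = 0 := by
  -- `D` extends `2 Re B`. Since `B` kills type `(0,1)` and `B̄` kills type `(1,0)`, one has `D ∘ P
  -- = B` and `D ∘ (1 - P) = B̄`, which accounts for the shape of `twistOp`.
  let D := cform B + cform (conjForm B)
  have hD : ∀ v w : V, D (incl v) (incl w) = 2 * ((B v w).re : ℂ) := fun v w => by
    simp only [D, LinearMap.add_apply, cform_incl, conjForm_apply, Complex.add_conj]
    push_cast
    ring
  have hcomp : D ∘ₗ twistOp (assocJ B) K z =
      (2 * Complex.I * z) • cform (twistForm B W z) := by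
    refine clinear_ext₂ fun v w => ?_
    simp only [twistOp, LinearMap.comp_apply, LinearMap.add_apply, LinearMap.sub_apply,
      LinearMap.smul_apply, map_add, map_sub, map_smul, proj10_apply, cext_incl, LinearMap.id_apply,
      hD, cform_incl, twistForm_apply, smul_eq_mul, form_assocJ hB, hK]
    have h1 : ((B v w).re : ℂ) = (B v w + starRingEnd ℂ (B v w)) / 2 := by
      rw [Complex.add_conj]; push_cast; ring
    have h2 : ((Complex.I * B v w).re : ℂ) =
        (Complex.I * B v w - Complex.I * starRingEnd ℂ (B v w)) / 2 := by
      have := Complex.add_conj (Complex.I * B v w)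
      rw [map_mul, Complex.conj_I] at this
      push_cast at this
      linear_combination -this / 2
    rw [h1, h2]
    field_simp
    linear_combination (B v w + z ^ 2 * starRingEnd ℂ (B v w) + B v w * z ^ 2
      + starRingEnd ℂ (B v w)) * Complex.I_sq
  -- `D` is nondegenerate: pairing with real vectors separates the real and imaginary parts, and
  -- each vanishes by `eq_zero_of_reForm`.
  obtain ⟨v, w, hvw⟩ := exists_eq_incl_add (twistOp (assocJ B) K z x)
  have h0 : ∀ u, (2 * ((B v u).re : ℂ)) + Complex.I * (2 * ((B w u).re : ℂ)) = 0 := by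
    intro u
    rw [← hD, ← hD, ← smul_eq_mul Complex.I, ← LinearMap.smul_apply, ← map_smul,
      ← LinearMap.add_apply, ← map_add, ← hvw, ← LinearMap.comp_apply, hcomp, LinearMap.smul_apply,
      LinearMap.smul_apply, mem_kerForm.1 hx, smul_zero]
  have hv : v = 0 := eq_zero_of_reForm hB hskew fun u => by
    simpa using congrArg Complex.re (h0 u)
  have hw : w = 0 := eq_zero_of_reForm hB hskew fun u => by
    simpa using congrArg Complex.im (h0 u)
  rw [hvw, hv, hw]
  simp

/-- The endomorphism that relates `ω₃` to `ω₁` anticommutes with `J₃` and squares to `-1`. -/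
theorem quaternionic_of_twistForm [FiniteDimensional ℝ V]
    (hB : IsCompl (kerForm B) (kerForm (conjForm B)))
    (hskew : ∀ v w, B v w = -B w v) {K : V →ₗ[ℝ] V} (hK : ∀ v w, W v w = (B (K v) w).re)
    (hfam : ∀ z : ℂ, z ≠ 0 →
      IsCompl (kerForm (twistForm B W z)) (kerForm (conjForm (twistForm B W z)))) :
    (∀ v, K (K v) = -v) ∧ ∀ v, K (assocJ B v) = -assocJ B (K v) := by
  set I := assocJ B with hI
  have hsq : ∀ v, I (I v) = -v := assocJ_sq hB
  set Q : Cplx V →ₗ[ℂ] Cplx V := LinearMap.id - proj10 I with hQdef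
  have hQmem : ∀ x, Q x ∈ T01 I := fun x => sub_proj10_mem hsq x
  have hfin : ∀ z : ℂ, z ≠ 0 →
      Module.finrank ℂ (kerForm (twistForm B W z)) = Module.finrank ℂ (T01 I) := by
    intro z hz
    have h1 := two_mul_finrank_of_isCompl (hfam z hz) fun _ => mem_kerForm_conjForm
    have h2 := two_mul_finrank_of_isCompl hB fun _ => mem_kerForm_conjForm
    rw [hI, T01_assocJ hB]
    omega
  -- On `ker ϖ(z)` the operator `P + izK + z²Q` vanishes, so `1 + izK + z²Q` reduces to `1 - P = Q`.
  -- Where it is injective, `Q` embeds the kernel in the `(0,1)`-space, and equality of dimensions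
  -- makes this onto.
  have key : ∀ u ∈ T01 I, ∀ z : ℂ, z ≠ 0 →
      Function.Injective (LinearMap.id + z • (Complex.I • cext K) + z ^ 2 • Q : Cplx V →ₗ[ℂ] Cplx V) →
      ∃ y, (LinearMap.id + z • (Complex.I • cext K) + z ^ 2 • Q : Cplx V →ₗ[ℂ] Cplx V) y = u ∧
        Q y = u ∧ twistOp I K z y = 0 := by
    intro u hu z hz hinj
    have hk : ∀ x ∈ kerForm (twistForm B W z),
        (LinearMap.id + z • (Complex.I • cext K) + z ^ 2 • Q : Cplx V →ₗ[ℂ] Cplx V) x = Q x := by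
      intro x hx
      have := twistOp_eq_zero hB hskew hK hz hx
      rw [twistOp] at this
      simp only [LinearMap.add_apply, LinearMap.smul_apply] at this
      have h2 : Q x = x - proj10 I x := rfl
      rw [← hQdef, ← hI] at this
      simp only [LinearMap.add_apply, LinearMap.smul_apply, LinearMap.id_apply]
      rw [← sub_eq_zero, ← this]
      nth_rewrite 2 [h2]
      module
    let f : kerForm (twistForm B W z) →ₗ[ℂ] T01 I :=
      (Q ∘ₗ (kerForm (twistForm B W z)).subtype).codRestrict _ fun x => hQmem _
    have hf : Function.Injective f := by
      intro x y hxy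
      have h1 : Q x = Q y := congrArg Subtype.val hxy
      rw [← hk x x.2, ← hk y y.2] at h1
      exact Subtype.ext (hinj h1)
    obtain ⟨y, hy⟩ := (LinearMap.injective_iff_surjective_of_finrank_eq_finrank (hfin z hz)).1 hf
      ⟨u, hu⟩
    have hQy : Q y = u := congrArg Subtype.val hy
    exact ⟨y, by rw [hk y y.2, hQy], hQy, twistOp_eq_zero hB hskew hK hz y.2⟩
  have hQ01 : ∀ x ∈ T01 I, Q x = x := fun x hx => by
    simp [hQdef, proj10_of_mem_T01 hx]
  have hQ10 : ∀ x ∈ T10 I, Q x = 0 := fun x hx => by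
    simp [hQdef, proj10_of_mem_T10 hx]
  -- Applying `Q` to the kernel equation kills the term `Py`. What remains is divisible by `z`,
  -- leaving `(iQK + zQ) y = 0` with `(1 + izK + z²Q) y = u`; the limit `z → 0` is `QKu = 0`.
  have hlim : ∀ u ∈ T01 I, (Complex.I • Q ∘ₗ cext K) u = 0 ∧ ∃ z : ℂ, z ≠ 0 ∧
      Function.Injective (LinearMap.id + z • (Complex.I • cext K) + z ^ 2 • Q : Cplx V →ₗ[ℂ] Cplx V) := by
    intro u hu
    refine apply_eq_zero_of_punctured _ _ _ Q u fun z hz hinj => ?_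
    obtain ⟨y, hy1, hy2, hy3⟩ := key u hu z hz hinj
    refine ⟨y, hy1, ?_⟩
    have h1 := congrArg Q hy3
    simp only [twistOp, LinearMap.add_apply, LinearMap.smul_apply, map_add, map_smul, map_zero,
      hQ10 _ (proj10_mem hsq y), ← hQdef, hQ01 _ (hQmem y), zero_add] at h1
    have h2 : z • ((Complex.I • Q ∘ₗ cext K + z • Q) y) = 0 := by
      rw [← h1]
      simp only [LinearMap.add_apply, LinearMap.smul_apply, LinearMap.comp_apply]
      module
    exact (smul_eq_zero.1 h2).resolve_left hz
  have h10 : ∀ u ∈ T01 I, cext K u ∈ T10 I := by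
    intro u hu
    have h1 := (hlim u hu).1
    simp only [LinearMap.smul_apply, LinearMap.comp_apply, smul_eq_zero, Complex.I_ne_zero,
      false_or] at h1
    have h2 : cext K u = proj10 I (cext K u) := sub_eq_zero.1 h1
    rw [h2]
    exact proj10_mem hsq _
  have h01 : ∀ a ∈ T10 I, cext K a ∈ T01 I := by
    intro a ha
    rw [← cconj_mem_T10, ← cext_cconj]
    exact h10 _ (cconj_mem_T01.2 ha)
  -- One good `z` suffices. For `y = a + u` the `(1,0)`-part of the kernel equation is `a + izKu =
  -- 0` and the `(0,1)`-part is `izKa + z²u = 0`; eliminating `a` gives `z²(K²u + u) = 0`.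
  have hsq01 : ∀ u ∈ T01 I, cext K (cext K u) = -u := by
    intro u hu
    obtain ⟨z, hz, hinj⟩ := (hlim u hu).2
    obtain ⟨y, -, hy2, hy3⟩ := key u hu z hz hinj
    set a := proj10 I y with ha
    have ha10 : a ∈ T10 I := proj10_mem hsq y
    have hy : y = a + u := by rw [← hy2, ha, hQdef]; simp
    have h1 : a + (Complex.I * z) • (cext K a + cext K u) + z ^ 2 • u = 0 := by
      rw [← hy3, twistOp]
      simp only [LinearMap.add_apply, LinearMap.smul_apply, ← hQdef, hy2, ← ha]
      rw [← map_add, ← hy]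
    have h2 := congrArg (proj10 I) h1
    simp only [map_add, map_smul, proj10_of_mem_T10 ha10, proj10_of_mem_T01 hu,
      proj10_of_mem_T01 (h01 a ha10), proj10_of_mem_T10 (h10 u hu), map_zero, smul_zero,
      zero_add, add_zero] at h2
    have h3 := congrArg (cext K) h2
    rw [map_add, map_smul, map_zero] at h3
    have h4 : (Complex.I * z) • (cext K a) + z ^ 2 • u = 0 := by
      rw [← h1, smul_add, ← sub_eq_zero, ← neg_eq_zero, ← h2]
      module
    have h5 : z ^ 2 • (cext K (cext K u) + u) = 0 := by
      have e : cext K a = -((Complex.I * z) • cext K (cext K u)) := eq_neg_of_add_eq_zero_left h3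
      rw [e, smul_neg, smul_smul] at h4
      rw [← h4, ← neg_smul, smul_add]
      congr 2
      linear_combination z ^ 2 * Complex.I_sq
    exact eq_neg_of_add_eq_zero_left ((smul_eq_zero.1 h5).resolve_left (pow_ne_zero 2 hz))
  -- A real vector is the sum of its `(1,0)`-part and the conjugate of that part, so both claims
  -- follow from those about types.
  have hv : ∀ v, incl v = proj10 I (incl v) + cconj (proj10 I (incl v)) := fun v =>
    (proj10_incl_add_cconj v).symm
  refine ⟨fun v => ?_, fun v => ?_⟩
  · apply incl_injective
    have ha : proj10 I (incl v) ∈ T10 I := proj10_mem hsq _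
    have hu := cconj_mem_T01.2 ha
    rw [← cext_incl, ← cext_incl, map_neg, hv v, map_add, map_add, hsq01 _ hu,
      ← cconj_cconj (proj10 I (incl v)), cext_cconj, cext_cconj, cconj_cconj, hsq01 _ hu, map_neg,
      cconj_cconj]
    abel
  · apply incl_injective
    have ha : proj10 I (incl v) ∈ T10 I := proj10_mem hsq _
    have hu := cconj_mem_T01.2 ha
    rw [← cext_incl, ← cext_incl, map_neg, ← cext_incl, ← cext_incl, hv v]
    simp only [map_add]
    rw [mem_T10.1 ha, mem_T01.1 hu, mem_T01.1 (h01 _ ha), mem_T10.1 (h10 _ hu)]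
    simp only [map_neg, map_smul, neg_add, neg_neg]

end TwistedFamily

/-! ### Stereographic projection -/

section SphereLemmas

theorem one_add_sq_ne (z : ℂ) : 1 + ‖z‖ ^ 2 ≠ 0 := by positivity

theorem sphereVec_chart0 (z : ℂ) : sphereVec (chart0 z) =
    ![2 * z.im / (1 + ‖z‖ ^ 2), -2 * z.re / (1 + ‖z‖ ^ 2), (1 - ‖z‖ ^ 2) / (1 + ‖z‖ ^ 2)] := rfl

theorem sphereVec_infty : sphereVec OnePoint.infty = ![0, 0, -1] := rfl

theorem sq_norm_eq (z : ℂ) : ‖z‖ ^ 2 = z.re ^ 2 + z.im ^ 2 := by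
  rw [← Complex.normSq_eq_norm_sq, Complex.normSq_apply]
  ring

theorem chartInf_zero : chartInf 0 = OnePoint.infty := if_pos rfl

theorem chartInf_of_ne {w : ℂ} (hw : w ≠ 0) : chartInf w = chart0 w⁻¹ := if_neg hw

/-- After clearing `|w|²` the formula holds at `w = 0` too, which makes the smoothness at `∞`
visible. -/
theorem sphereVec_chartInf (w : ℂ) : sphereVec (chartInf w) =
    ![-2 * w.im / (1 + ‖w‖ ^ 2), -2 * w.re / (1 + ‖w‖ ^ 2), (‖w‖ ^ 2 - 1) / (1 + ‖w‖ ^ 2)] := by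
  rcases eq_or_ne w 0 with rfl | hw
  · rw [chartInf_zero, sphereVec_infty]
    simp
  · have h := one_add_sq_ne w
    have h1 : ‖w‖ ≠ 0 := norm_ne_zero_iff.2 hw
    rw [chartInf_of_ne hw, sphereVec_chart0, norm_inv, Complex.inv_re, Complex.inv_im,
      Complex.normSq_eq_norm_sq]
    have e0 : (1 + ‖w‖⁻¹ ^ 2) = (1 + ‖w‖ ^ 2) / ‖w‖ ^ 2 := by field_simp; ring
    rw [e0]
    congr 1
    · field_simp
    · congr 1
      · field_simp
      · congr 1
        field_simp

theorem antipode_infty : antipode OnePoint.infty = chart0 0 := rfl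

theorem antipode_chart0 (z : ℂ) : antipode (chart0 z) = chartInf (-(starRingEnd ℂ z)) := rfl

theorem antipode_zero : antipode (chart0 0) = OnePoint.infty := by
  rw [antipode_chart0, map_zero, neg_zero, chartInf_zero]

theorem sphereVec_antipode (p : P1) (α : Fin 3) : sphereVec (antipode p) α = -sphereVec p α := by
  induction p using OnePoint.rec with
  | infty => rw [antipode_infty, sphereVec_chart0, sphereVec_infty]; (fin_cases α <;> simp)
  | coe z =>
    change sphereVec (antipode (chart0 z)) α = -sphereVec (chart0 z) α
    rw [antipode_chart0, sphereVec_chartInf, sphereVec_chart0]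
    fin_cases α <;> simp <;> ring

theorem sphereVec_sq (p : P1) : sphereVec p 0 ^ 2 + sphereVec p 1 ^ 2 + sphereVec p 2 ^ 2 = 1 := by
  induction p using OnePoint.rec with
  | infty => rw [sphereVec_infty]; simp
  | coe z =>
    change sphereVec (chart0 z) 0 ^ 2 + sphereVec (chart0 z) 1 ^ 2 + sphereVec (chart0 z) 2 ^ 2 = 1
    have h := one_add_sq_ne z
    rw [sphereVec_chart0]
    simp only [Matrix.cons_val]
    field_simp
    rw [sq_norm_eq]
    ring

theorem sphereVec_basePt (α : Fin 3) : sphereVec (basePt α) = Pi.single α 1 := by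
  fin_cases α
  · change sphereVec (chart0 Complex.I) = _
    rw [sphereVec_chart0]
    funext i
    fin_cases i <;> norm_num
  · change sphereVec (chart0 (-1)) = _
    rw [sphereVec_chart0]
    funext i
    fin_cases i <;> norm_num
  · change sphereVec (chart0 0) = _
    rw [sphereVec_chart0]
    funext i; fin_cases i <;> simp

theorem contDiff_sphereVec_chart0 (α : Fin 3) :
    ContDiff ℝ ∞ fun z : ℂ => (sphereVec (chart0 z) α : ℂ) := by
  suffices h : ContDiff ℝ ∞ fun z : ℂ => sphereVec (chart0 z) α from
    Complex.ofRealCLM.contDiff.comp h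
  have h1 : ContDiff ℝ ∞ fun z : ℂ => 1 + ‖z‖ ^ 2 := contDiff_const.add (contDiff_norm_sq ℝ)
  have hre : ContDiff ℝ ∞ fun z : ℂ => z.re := Complex.reCLM.contDiff
  have him : ContDiff ℝ ∞ fun z : ℂ => z.im := Complex.imCLM.contDiff
  simp only [sphereVec_chart0]
  fin_cases α
  · exact (contDiff_const.mul him).div h1 one_add_sq_ne
  · exact (contDiff_const.mul hre).div h1 one_add_sq_ne
  · exact (contDiff_const.sub (contDiff_norm_sq ℝ)).div h1 one_add_sq_ne

theorem contDiff_sphereVec_chartInf (α : Fin 3) :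
    ContDiff ℝ ∞ fun z : ℂ => (sphereVec (chartInf z) α : ℂ) := by
  suffices h : ContDiff ℝ ∞ fun z : ℂ => sphereVec (chartInf z) α from
    Complex.ofRealCLM.contDiff.comp h
  have h1 : ContDiff ℝ ∞ fun z : ℂ => 1 + ‖z‖ ^ 2 := contDiff_const.add (contDiff_norm_sq ℝ)
  have hre : ContDiff ℝ ∞ fun z : ℂ => z.re := Complex.reCLM.contDiff
  have him : ContDiff ℝ ∞ fun z : ℂ => z.im := Complex.imCLM.contDiff
  simp only [sphereVec_chartInf]
  fin_cases α
  · exact (contDiff_const.mul him).div h1 one_add_sq_ne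
  · exact (contDiff_const.mul hre).div h1 one_add_sq_ne
  · exact ((contDiff_norm_sq ℝ).sub contDiff_const).div h1 one_add_sq_ne

theorem infty_or_chart0 (p : P1) : p = OnePoint.infty ∨ ∃ z, p = chart0 z := by
  induction p using OnePoint.rec with
  | infty => exact Or.inl rfl
  | coe z => exact Or.inr ⟨z, rfl⟩

theorem chart0_ne_infty (z : ℂ) : chart0 z ≠ OnePoint.infty := OnePoint.coe_ne_infty z

theorem chart0_injective : Function.Injective chart0 := OnePoint.coe_injective

end SphereLemmas

/-! ### Families of complex structures from the quaternions -/

section QuaternionicFamily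

variable {V : Type*} [AddCommGroup V] [Module ℝ V]

/-- Families of complex structures on a vector space that come from the unit imaginary
quaternions, `J₁ = J i`, `J₃ = J 0`, `J₂ = J₃ J₁`. -/
structure IsQuatFamily (J : P1 → V →ₗ[ℝ] V) : Prop where
  sq₁ : ∀ v, J (chart0 Complex.I) (J (chart0 Complex.I) v) = -v
  sq₃ : ∀ v, J (chart0 0) (J (chart0 0) v) = -v
  anti : ∀ v, J (chart0 0) (J (chart0 Complex.I) v) = -J (chart0 Complex.I) (J (chart0 0) v)
  eq_sum : ∀ p v, J p v = sphereVec p 0 • J (chart0 Complex.I) v +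
    sphereVec p 1 • J (chart0 0) (J (chart0 Complex.I) v) + sphereVec p 2 • J (chart0 0) v

namespace IsQuatFamily

variable {J : P1 → V →ₗ[ℝ] V} (hJ : IsQuatFamily J)
include hJ

theorem sq (p : P1) (v : V) : J p (J p v) = -v := by
  rw [hJ.eq_sum p v, hJ.eq_sum p]
  simp only [map_add, map_smul, hJ.sq₁, hJ.sq₃, hJ.anti, map_neg]
  have h := sphereVec_sq p
  match_scalars <;> first | linear_combination -h | ring

theorem apply_antipode (p : P1) (v : V) : J (antipode p) v = -J p v := by
  rw [hJ.eq_sum p, hJ.eq_sum]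
  simp only [sphereVec_antipode]
  module

theorem cext_eq (p : P1) (x : Cplx V) : cext (J p) x =
    (sphereVec p 0 : ℂ) • cext (J (chart0 Complex.I)) x +
    (sphereVec p 1 : ℂ) • cext (J (chart0 0)) (cext (J (chart0 Complex.I)) x) +
    (sphereVec p 2 : ℂ) • cext (J (chart0 0)) x := by
  rw [← cext_comp_apply, ← cext_smul_apply, ← cext_smul_apply, ← cext_smul_apply,
    ← cext_add_apply, ← cext_add_apply]
  exact cext_ext (fun v => hJ.eq_sum p v) x

theorem cext_anti (x : Cplx V) : cext (J (chart0 0)) (cext (J (chart0 Complex.I)) x) =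
    -cext (J (chart0 Complex.I)) (cext (J (chart0 0)) x) := by
  rw [← cext_comp_apply, ← cext_comp_apply, ← cext_neg_apply]
  exact cext_ext hJ.anti x

theorem J₁_mem_T01 {a : Cplx V} (ha : a ∈ T10 (J (chart0 0))) :
    cext (J (chart0 Complex.I)) a ∈ T01 (J (chart0 0)) := by
  rw [mem_T01, hJ.cext_anti, mem_T10.1 ha, map_smul]

theorem J₁_mem_T10 {a : Cplx V} (ha : a ∈ T01 (J (chart0 0))) :
    cext (J (chart0 Complex.I)) a ∈ T10 (J (chart0 0)) := by
  rw [mem_T10, hJ.cext_anti, mem_T01.1 ha, map_neg, map_smul, neg_neg]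

/-- `J₁` exchanges the types over `0`, so `J₃J₁a = -iJ₁a` and the first two terms merge. -/
theorem cext_of_mem_T10 (p : P1) {a : Cplx V} (ha : a ∈ T10 (J (chart0 0))) : cext (J p) a =
    ((sphereVec p 0 : ℂ) - Complex.I * sphereVec p 1) • cext (J (chart0 Complex.I)) a +
      (Complex.I * sphereVec p 2) • a := by
  rw [hJ.cext_eq, mem_T01.1 (hJ.J₁_mem_T01 ha), mem_T10.1 ha]
  module

theorem cext_of_mem_T01 (p : P1) {a : Cplx V} (ha : a ∈ T01 (J (chart0 0))) : cext (J p) a =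
    ((sphereVec p 0 : ℂ) + Complex.I * sphereVec p 1) • cext (J (chart0 Complex.I)) a -
      (Complex.I * sphereVec p 2) • a := by
  rw [hJ.cext_eq, mem_T10.1 (hJ.J₁_mem_T10 ha), mem_T01.1 ha]
  module

/-- The vectors of type `(0,1)` over `z` are of the form `J₁ a - z a`. -/
theorem J₁_sub_mem_T01 {a : Cplx V} (ha : a ∈ T10 (J (chart0 0))) (z : ℂ) :
    cext (J (chart0 Complex.I)) a - z • a ∈ T01 (J (chart0 z)) := by
  rw [mem_T01, map_sub, map_smul, hJ.cext_of_mem_T01 (chart0 z) (hJ.J₁_mem_T01 ha),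
    hJ.cext_of_mem_T10 (chart0 z) ha,
    cext_sq hJ.sq₁, sphereVec_chart0]
  simp only [Matrix.cons_val]
  have h : (1 + (‖z‖ : ℂ) ^ 2) ≠ 0 := by exact_mod_cast one_add_sq_ne z
  have hn : (‖z‖ : ℂ) ^ 2 = (z.re : ℂ) ^ 2 + (z.im : ℂ) ^ 2 := by exact_mod_cast sq_norm_eq z
  have hz : z = z.re + z.im * Complex.I := (Complex.re_add_im z).symm
  push_cast
  match_scalars
  · field_simp
    rw [hn]
    generalize (z.re : ℂ) = x at *
    generalize (z.im : ℂ) = y at *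
    subst hz
    linear_combination (-(2 * y) : ℂ) * Complex.I_sq
  · field_simp
    rw [hn]
    generalize (z.re : ℂ) = x at *
    generalize (z.im : ℂ) = y at *
    subst hz
    linear_combination (-(2 * x * y) : ℂ) * Complex.I_sq

/-- The `(1,0)`-part over `0` of `J^(z) a = -ia` reads `i(c₃ + 1) a = 0`, and `c₃ = -1` only at `∞`.
-/
theorem T01_inf_T10_zero {z : ℂ} {a : Cplx V} (ha : a ∈ T10 (J (chart0 0)))
    (h : a ∈ T01 (J (chart0 z))) : a = 0 := by
  have h1 := congrArg (proj10 (J (chart0 0))) (mem_T01.1 h)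
  rw [hJ.cext_of_mem_T10 _ ha] at h1
  simp only [map_add, map_smul, map_neg, proj10_of_mem_T10 ha,
    proj10_of_mem_T01 (hJ.J₁_mem_T01 ha), smul_zero, zero_add] at h1
  have h2 : (Complex.I * (sphereVec (chart0 z) 2 + 1)) • a = 0 := by
    rw [mul_add, add_smul, h1]
    module
  refine (smul_eq_zero.1 h2).resolve_left (mul_ne_zero Complex.I_ne_zero ?_)
  rw [sphereVec_chart0]
  simp only [Matrix.cons_val]
  have h := one_add_sq_ne z
  have : (1 - ‖z‖ ^ 2) / (1 + ‖z‖ ^ 2) + 1 ≠ 0 := by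
    have : (1 - ‖z‖ ^ 2) / (1 + ‖z‖ ^ 2) + 1 = 2 / (1 + ‖z‖ ^ 2) := by field_simp; ring
    rw [this]; positivity
  exact_mod_cast this

theorem mem_T01_infty {x : Cplx V} : x ∈ T01 (J OnePoint.infty) ↔ x ∈ T10 (J (chart0 0)) := by
  rw [mem_T01, mem_T10, ← antipode_zero,
    cext_ext (A' := -J (chart0 0)) (hJ.apply_antipode (chart0 0)), cext_neg_apply, neg_inj]

/-- The counterpart of `T01_inf_T10_zero`: here the obstruction is `c₃ = 1`, which occurs only at
`0`. At `∞` the types are those over `0`, interchanged. -/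
theorem T01_inf_T01_zero {p : P1} (hp : p ≠ chart0 0) {a : Cplx V} (ha : a ∈ T01 (J (chart0 0)))
    (h : a ∈ T01 (J p)) : a = 0 := by
  rcases infty_or_chart0 p with rfl | ⟨z, rfl⟩
  · exact T10_inf_T01 (hJ.mem_T01_infty.1 h) ha
  have hz : z ≠ 0 := fun h => hp (by rw [h])
  have h3 := mem_T01.1 h
  rw [hJ.cext_of_mem_T01 _ ha, sub_eq_iff_eq_add] at h3
  have h4 : ((sphereVec (chart0 z) 0 : ℂ) + Complex.I * sphereVec (chart0 z) 1) •
      cext (J (chart0 Complex.I)) a = 0 := by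
    have h5 := congrArg (proj10 (J (chart0 0))) h3
    simpa only [map_smul, map_add, map_neg, proj10_of_mem_T01 ha,
      proj10_of_mem_T10 (hJ.J₁_mem_T10 ha), smul_zero, neg_zero, add_zero] using h5
  rw [h4] at h3
  have h2 : (Complex.I * (sphereVec (chart0 z) 2 - 1)) • a = 0 := by
    rw [h3]
    module
  refine (smul_eq_zero.1 h2).resolve_left (mul_ne_zero Complex.I_ne_zero ?_)
  rw [sphereVec_chart0]
  simp only [Matrix.cons_val]
  have h := one_add_sq_ne z
  have : (1 - ‖z‖ ^ 2) / (1 + ‖z‖ ^ 2) - 1 ≠ 0 := by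
    have e : (1 - ‖z‖ ^ 2) / (1 + ‖z‖ ^ 2) - 1 = -(2 * ‖z‖ ^ 2) / (1 + ‖z‖ ^ 2) := by
      field_simp; ring
    rw [e]
    have : ‖z‖ ≠ 0 := norm_ne_zero_iff.2 hz
    refine div_ne_zero (neg_ne_zero.2 (by positivity)) h
  exact_mod_cast this

/-- The dimension of a quaternionic vector space is divisible by four. -/
theorem four_dvd_finrank : 4 ∣ Module.finrank ℝ V := by
  let q : QuaternionAlgebra.Basis (Module.End ℝ V) (-1 : ℝ) 0 (-1) :=
    { i := J (chart0 Complex.I)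
      j := J (chart0 0)
      k := J (chart0 Complex.I) * J (chart0 0)
      i_mul_i := by
        refine LinearMap.ext fun v => ?_
        simp [Module.End.mul_apply, hJ.sq₁]
      j_mul_j := by
        refine LinearMap.ext fun v => ?_
        simp [Module.End.mul_apply, hJ.sq₃]
      i_mul_j := rfl
      j_mul_i := by
        refine LinearMap.ext fun v => ?_
        simp [Module.End.mul_apply, hJ.anti] }
  -- The representation makes `V` a module over a division ring of real dimension four; such a
  -- module is free, so dimensions multiply.
  let φ : Quaternion ℝ →ₐ[ℝ] Module.End ℝ V := QuaternionAlgebra.lift q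
  let : Module (Quaternion ℝ) V := Module.compHom V φ.toRingHom
  have : IsScalarTower ℝ (Quaternion ℝ) V := by
    refine ⟨fun c x v => ?_⟩
    change φ (c • x) v = c • φ x v
    rw [map_smul, LinearMap.smul_apply]
  have := Module.finrank_mul_finrank ℝ (Quaternion ℝ) V
  rw [Quaternion.finrank_eq_four] at this
  exact ⟨_, this.symm⟩

end IsQuatFamily

end QuaternionicFamily

/-! ### Holomorphic and real sections over a twistor line -/

section TwistorLineSections

variable {V : Type*} [AddCommGroup V] [Module ℝ V]

namespace IsQuatFamily

variable {J : P1 → V →ₗ[ℝ] V} (hJ : IsQuatFamily J)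
include hJ

/-- The projections of a fixed vector to the spaces of vectors of type `(1,0)` form a holomorphic
section of the normal bundle. -/
theorem isHolSection_proj10 (x : Cplx V) (U : Set P1) :
    IsHolSection J U fun p => proj10 (J p) x := by
  refine ⟨fun p _ => proj10_mem (hJ.sq p) x, fun φ => ?_, fun U' _ _ σ hσ => ?_⟩
  · have h : ∀ p, φ (proj10 (J p) x) = 2⁻¹ * (φ x - Complex.I *
        ((sphereVec p 0 : ℂ) * φ (cext (J (chart0 Complex.I)) x) +
        (sphereVec p 1 : ℂ) * φ (cext (J (chart0 0)) (cext (J (chart0 Complex.I)) x)) +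
        (sphereVec p 2 : ℂ) * φ (cext (J (chart0 0)) x))) := fun p => by
      rw [proj10_apply, hJ.cext_eq]
      simp only [map_smul, map_sub, map_add, smul_eq_mul]
    simp only [h]
    constructor
    · exact ContDiff.contDiffOn (contDiff_const.mul (contDiff_const.sub (contDiff_const.mul
        ((((contDiff_sphereVec_chart0 0).mul contDiff_const).add
        ((contDiff_sphereVec_chart0 1).mul contDiff_const)).add
        ((contDiff_sphereVec_chart0 2).mul contDiff_const)))))
    · exact ContDiff.contDiffOn (contDiff_const.mul (contDiff_const.sub (contDiff_const.mul
        ((((contDiff_sphereVec_chartInf 0).mul contDiff_const).add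
        ((contDiff_sphereVec_chartInf 1).mul contDiff_const)).add
        ((contDiff_sphereVec_chartInf 2).mul contDiff_const)))))
  -- A `(1,0)`-covector kills the `(0,1)`-part, so the pairing is `σ(x)` with `x` constant.
  · obtain ⟨h0, hi⟩ := hσ.2 x
    exact ⟨h0.congr fun z hz => coT10_proj10 (hJ.sq _) (hσ.1 _ hz) x,
      hi.congr fun z hz => coT10_proj10 (hJ.sq _) (hσ.1 _ hz) x⟩

/-- Conjugation turns `1 - iJ` into `1 + iJ`, and the antipodal structure is `-J`. -/
theorem cconj_proj10 (p : P1) (v : V) :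
    cconj (proj10 (J p) (incl v)) = proj10 (J (antipode p)) (incl v) := by
  rw [proj10_apply, proj10_apply, cext_ext (A := J (antipode p)) (A' := -J p) (hJ.apply_antipode p),
    cext_neg_apply, cconj_smul, map_sub, cconj_smul, ← cext_cconj, cconj_incl, Complex.conj_I]
  simp only [map_inv₀, map_ofNat]
  module

/-- The real holomorphic section defined by a real tangent vector. -/
def realSection (v : V) : realHolSections J :=
  ⟨fun p => proj10 (J p) (incl v), hJ.isHolSection_proj10 _ _, fun p => hJ.cconj_proj10 p v⟩

theorem realSection_apply (v : V) (p : P1) :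
    (hJ.realSection v : P1 → Cplx V) p = proj10 (J p) (incl v) := rfl

/-- Split `x = a + b` by type over `0`. Subtracting `b + zJ₁b`, which has type `(0,1)` over `z`,
leaves `a - zJ₁b`, of type `(1,0)` over `0` and `(0,1)` over `z`, hence zero; but this is the
`(1,0)`-part of `(1 - zJ₁)x`. Dually, composition with `1 - zJ₁` carries `(1,0)`-covectors over `0`
to `(1,0)`-covectors over `z`. -/
theorem sub_J₁_mem_T01 {z : ℂ} {x : Cplx V} (hx : x ∈ T01 (J (chart0 z))) :
    x - z • cext (J (chart0 Complex.I)) x ∈ T01 (J (chart0 0)) := by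
  set a := proj10 (J (chart0 0)) x with ha
  obtain ⟨b, hb⟩ : ∃ b, b = x - a := ⟨_, rfl⟩
  have ha10 : a ∈ T10 (J (chart0 0)) := proj10_mem hJ.sq₃ x
  have hb01 : b ∈ T01 (J (chart0 0)) := hb ▸ sub_proj10_mem hJ.sq₃ x
  have hJb := hJ.J₁_mem_T10 hb01
  have h1 := neg_mem (hJ.J₁_sub_mem_T01 hJb z)
  rw [cext_sq hJ.sq₁] at h1
  have h2 : a - z • cext (J (chart0 Complex.I)) b = 0 := by
    refine hJ.T01_inf_T10_zero (z := z) (sub_mem ha10 (Submodule.smul_mem _ _ hJb)) ?_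
    have h3 := sub_mem hx h1
    have h4 : x = a + b := by rw [hb]; abel
    rw [h4] at h3
    convert h3 using 1
    abel
  have h4 : x - z • cext (J (chart0 Complex.I)) x =
      (a - z • cext (J (chart0 Complex.I)) b) + (b - z • cext (J (chart0 Complex.I)) a) := by
    have h4 : x = a + b := by rw [hb]; abel
    rw [h4, map_add]
    module
  rw [h4, h2, zero_add]
  exact sub_mem hb01 (Submodule.smul_mem _ _ (hJ.J₁_mem_T01 ha10))

/-- The coordinate of the projection of a constant vector. -/
theorem coord_proj10 (x : Cplx V) (z : ℂ) : coord J (fun p => proj10 (J p) x) z =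
    proj10 (J (chart0 0)) (x - z • cext (J (chart0 Complex.I)) x) := by
  have h := hJ.sub_J₁_mem_T01 (sub_proj10_mem (hJ.sq (chart0 z)) x)
  rw [← proj10_eq_zero_iff hJ.sq₃] at h
  rw [coord, ← sub_eq_zero, ← neg_eq_zero, ← h, ← map_sub, ← map_neg]
  congr 1
  rw [map_sub]
  module

theorem coord_realSection (v : V) (z : ℂ) : coord J (hJ.realSection v) z =
    proj10 (J (chart0 0)) (incl v) -
      z • cext (J (chart0 Complex.I)) (cconj (proj10 (J (chart0 0)) (incl v))) := by
  have ha : proj10 (J (chart0 0)) (incl v) ∈ T10 (J (chart0 0)) := proj10_mem hJ.sq₃ _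
  have hc := cconj_mem_T01.2 ha
  refine (hJ.coord_proj10 (incl v) z).trans ?_
  conv_lhs => rw [map_sub, map_smul]
  congr 2
  conv_lhs => rw [← proj10_incl_add_cconj (J := J (chart0 0)) v]
  rw [map_add, map_add, proj10_of_mem_T01 (hJ.J₁_mem_T01 ha), proj10_of_mem_T10 (hJ.J₁_mem_T10 hc),
    zero_add]

/-- For `x = a + b`, split by type over `0`, the coordinate is `a - zJ₁b`. If it vanishes, `x = b +
zJ₁b` has type `(0,1)` over `z` as well as `(1,0)`. -/
theorem eq_zero_of_coord {z : ℂ} {s : P1 → Cplx V} (hs : s (chart0 z) ∈ T10 (J (chart0 z)))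
    (h : coord J s z = 0) : s (chart0 z) = 0 := by
  set x := s (chart0 z) with hx
  set a := proj10 (J (chart0 0)) x with ha
  obtain ⟨b, hb⟩ : ∃ b, b = x - a := ⟨_, rfl⟩
  have ha10 : a ∈ T10 (J (chart0 0)) := proj10_mem hJ.sq₃ x
  have hb01 : b ∈ T01 (J (chart0 0)) := hb ▸ sub_proj10_mem hJ.sq₃ x
  have hJb := hJ.J₁_mem_T10 hb01
  have hxab : x = a + b := by rw [hb]; abel
  have h0 : a - z • cext (J (chart0 Complex.I)) b = 0 := by
    rw [← h, coord, ← hx]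
    conv_rhs => rw [hxab]
    rw [map_add (cext _) a b, map_sub, map_smul, map_add, map_add, proj10_of_mem_T10 ha10,
      proj10_of_mem_T01 hb01, proj10_of_mem_T01 (hJ.J₁_mem_T01 ha10), proj10_of_mem_T10 hJb,
      zero_add, add_zero]
  have h1 := neg_mem (hJ.J₁_sub_mem_T01 hJb z)
  rw [cext_sq hJ.sq₁] at h1
  have h2 : -(-b - z • cext (J (chart0 Complex.I)) b) = x := by
    rw [hxab, sub_eq_zero.1 h0]
    abel
  rw [h2] at h1
  exact T10_inf_T01 hs h1

/-- Holomorphic sections of the bundle of `(1,0)`-covectors over the affine line. -/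
theorem isHolCosection_chart0 {τ : Module.Dual ℂ (Cplx V)} (hτ : τ ∈ coT10 (J (chart0 0))) :
    IsHolCosection J {OnePoint.infty}ᶜ
      (fun p => OnePoint.elim p 0 fun z => τ - z • (τ ∘ₗ cext (J (chart0 Complex.I)))) := by
  refine ⟨fun p hp => ?_, fun x => ⟨?_, ?_⟩⟩
  · rcases infty_or_chart0 p with rfl | ⟨z, rfl⟩
    · exact absurd rfl hp
    · refine (mem_coT10_iff (hJ.sq _)).2 fun x hx => ?_
      have := (mem_coT10_iff hJ.sq₃).1 hτ _ (hJ.sub_J₁_mem_T01 hx)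
      rwa [map_sub, map_smul] at this
  · change DifferentiableOn ℂ (fun z : ℂ => τ x - z * τ (cext (J (chart0 Complex.I)) x)) _
    fun_prop
  · have h : DifferentiableOn ℂ (fun w : ℂ => τ x - w⁻¹ * τ (cext (J (chart0 Complex.I)) x))
        (chartInf ⁻¹' {OnePoint.infty}ᶜ) := by
      have : DifferentiableOn ℂ (fun w : ℂ => w⁻¹) (chartInf ⁻¹' {OnePoint.infty}ᶜ) :=
        differentiableOn_inv.mono fun w hw h0 => hw (by rw [h0, chartInf_zero]; rfl)
      fun_prop
    refine h.congr fun w hw => ?_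
    have hw0 : w ≠ 0 := fun h0 => hw (by rw [h0, chartInf_zero]; rfl)
    simp only [chartInf_of_ne hw0]
    rfl

/-- Holomorphic sections of the bundle of `(1,0)`-covectors away from the origin. -/
theorem isHolCosection_chartInf {τ : Module.Dual ℂ (Cplx V)} (hτ : τ ∈ coT10 (J (chart0 0))) :
    IsHolCosection J {chart0 0}ᶜ
      (fun p => OnePoint.elim p (-(τ ∘ₗ cext (J (chart0 Complex.I))))
        fun z => z⁻¹ • τ - τ ∘ₗ cext (J (chart0 Complex.I))) := by
  refine ⟨fun p hp => ?_, fun x => ⟨?_, ?_⟩⟩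
  · rcases infty_or_chart0 p with rfl | ⟨z, rfl⟩
    · refine (mem_coT10_iff (hJ.sq _)).2 fun x hx => ?_
      have := (mem_coT10_iff hJ.sq₃).1 hτ _ (hJ.J₁_mem_T01 (hJ.mem_T01_infty.1 hx))
      simpa using this
    · have hz : z ≠ 0 := fun h => hp (by rw [h]; rfl)
      refine (mem_coT10_iff (hJ.sq _)).2 fun x hx => ?_
      have := (mem_coT10_iff hJ.sq₃).1 hτ _ (hJ.sub_J₁_mem_T01 hx)
      rw [map_sub, map_smul] at this
      have h2 : z⁻¹ • τ x - τ (cext (J (chart0 Complex.I)) x) =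
          z⁻¹ • (τ x - z • τ (cext (J (chart0 Complex.I)) x)) := by
        rw [smul_sub, smul_smul, inv_mul_cancel₀ hz, one_smul]
      exact h2.trans (by rw [this, smul_zero])
  · change DifferentiableOn ℂ (fun z : ℂ => z⁻¹ * τ x - τ (cext (J (chart0 Complex.I)) x)) _
    have : DifferentiableOn ℂ (fun w : ℂ => w⁻¹) (chart0 ⁻¹' {chart0 0}ᶜ) :=
      differentiableOn_inv.mono fun w hw h0 => hw (by rw [h0]; rfl)
    fun_prop
  · have h : DifferentiableOn ℂ (fun w : ℂ => w * τ x - τ (cext (J (chart0 Complex.I)) x))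
        (chartInf ⁻¹' {chart0 0}ᶜ) := by
      fun_prop
    refine h.congr fun w _ => ?_
    rcases eq_or_ne w 0 with rfl | hw0
    · rw [chartInf_zero]
      change -τ (cext (J (chart0 Complex.I)) x) = _
      ring
    · rw [chartInf_of_ne hw0]
      change (w⁻¹)⁻¹ * τ x - τ (cext (J (chart0 Complex.I)) x) = _
      rw [inv_inv]

/-- A holomorphic section of the normal bundle that vanishes at `0` and `∞` vanishes. -/
theorem eq_zero_of_vanishing {s : P1 → Cplx V} (hs : IsHolSection J Set.univ s)
    (h0 : s (chart0 0) = 0) (hi : s OnePoint.infty = 0) (p : P1) : s p = 0 := by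
  rcases infty_or_chart0 p with rfl | ⟨z, rfl⟩
  · exact hi
  refine hJ.eq_zero_of_coord (hs.1 _ trivial) (eq_zero_of_forall_dual fun φ => ?_)
  set τ := φ ∘ₗ proj10 (J (chart0 0)) with hτdef
  have hτ : τ ∈ coT10 (J (chart0 0)) := comp_proj10_mem_coT10 hJ.sq₃ φ
  set f : ℂ → ℂ := fun z => τ (s (chart0 z)) - z * τ (cext (J (chart0 Complex.I)) (s (chart0 z)))
    with hf
  have hcoord : ∀ z, φ (coord J s z) = f z := fun z => by
    rw [coord, hf, hτdef]
    simp only [map_sub, map_smul, smul_eq_mul, LinearMap.comp_apply]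
  have hfd : Differentiable ℂ f := by
    have h := (hs.2.2 _ isOpen_compl_singleton (Set.subset_univ _) _
      (hJ.isHolCosection_chart0 hτ)).1
    have hu : chart0 ⁻¹' {OnePoint.infty}ᶜ = Set.univ :=
      Set.eq_univ_of_forall fun z => chart0_ne_infty z
    rw [hu, differentiableOn_univ] at h
    exact h
  -- The cosection near `∞` is `z⁻¹` times the one over `ℂ`, so pairing with it extends `f(z)/z`
  -- holomorphically over `∞`; there the value is `0` because `s` vanishes.
  obtain ⟨g, hgd, hg0, hg⟩ : ∃ g : ℂ → ℂ, Differentiable ℂ g ∧ g 0 = 0 ∧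
      ∀ w, w ≠ 0 → g w = w * f w⁻¹ := by
    have h := (hs.2.2 _ isOpen_compl_singleton (Set.subset_univ _) _
      (hJ.isHolCosection_chartInf hτ)).2
    have hu : chartInf ⁻¹' {chart0 0}ᶜ = Set.univ := by
      refine Set.eq_univ_of_forall fun w hw => ?_
      rcases eq_or_ne w 0 with rfl | hw0
      · rw [chartInf_zero] at hw
        exact chart0_ne_infty 0 hw.symm
      · rw [chartInf_of_ne hw0] at hw
        exact inv_ne_zero hw0 (chart0_injective hw)
    rw [hu, differentiableOn_univ] at h
    refine ⟨_, h, ?_, fun w hw => ?_⟩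
    · simp only [chartInf_zero, hi, map_zero]
    · simp only [chartInf_of_ne hw]
      change (w⁻¹)⁻¹ * τ (s (chart0 w⁻¹)) - τ (cext (J (chart0 Complex.I)) (s (chart0 w⁻¹))) = _
      rw [hf]
      field_simp
  have hf0 : f 0 = 0 := by simp [hf, h0]
  -- As `f(0) = 0`, the function `dslope f 0` is `f(z)/z` with its singularity removed. It is entire
  -- and tends to `g(0) = 0` at infinity, so Liouville's theorem applies.
  have hd : Differentiable ℂ (dslope f 0) := by
    rw [← differentiableOn_univ] at hfd ⊢
    exact (Complex.differentiableOn_dslope Filter.univ_mem).2 hfd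
  have ht : Filter.Tendsto (dslope f 0) (Filter.cocompact ℂ) (nhds 0) := by
    have h1 : Filter.Tendsto (fun z : ℂ => g z⁻¹) (Filter.cocompact ℂ) (nhds 0) := by
      rw [← hg0]
      exact (hgd.continuous.tendsto 0).comp (by
        rw [← Metric.cobounded_eq_cocompact]
        exact Filter.tendsto_inv₀_cobounded)
    refine h1.congr' ?_
    have : ∀ᶠ z in Filter.cocompact ℂ, z ≠ 0 := by
      rw [← Metric.cobounded_eq_cocompact]
      exact Bornology.eventually_ne_cobounded 0
    filter_upwards [this] with z hz
    rw [hg _ (inv_ne_zero hz), inv_inv, dslope_of_ne _ hz, slope_def_field, hf0, sub_zero, sub_zero]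
    field_simp
  have hz := hd.apply_eq_of_tendsto_cocompact z ht
  rw [hcoord]
  rcases eq_or_ne z 0 with rfl | hz0
  · exact hf0
  · rw [dslope_of_ne _ hz0, slope_def_field, hf0, sub_zero, sub_zero, div_eq_zero_iff] at hz
    exact hz.resolve_right hz0

/-- The isomorphism of the tangent space with the space of real holomorphic sections. -/
def realSectionEquiv : V ≃ₗ[ℝ] realHolSections J :=
  LinearEquiv.ofBijective
    { toFun := hJ.realSection
      map_add' := fun v w => Subtype.ext (funext fun p => by
        simp only [realSection_apply, Submodule.coe_add, Pi.add_apply, map_add])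
      map_smul' := fun c v => Subtype.ext (funext fun p => by
        simp only [realSection_apply, Submodule.coe_smul, Pi.smul_apply, map_smul, RingHom.id_apply,
          real_smul_eq]) }
    (by
      refine ⟨fun v w h => ?_, fun s => ?_⟩
      · exact proj10_incl_injective (congrFun (congrArg Subtype.val h) (chart0 0))
      · have ha : (s : P1 → Cplx V) (chart0 0) ∈ T10 (J (chart0 0)) := s.2.1.1 _ trivial
        -- The real vector `s(0) + conj s(0)` has `(1,0)`-part `s(0)` over `0`. Its section thus
        -- agrees with `s` at `0` and, by reality, at `∞`.
        obtain ⟨v, hv⟩ := exists_incl_of_cconj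
          (x := (s : P1 → Cplx V) (chart0 0) + cconj ((s : P1 → Cplx V) (chart0 0)))
          (by rw [map_add, cconj_cconj, add_comm])
        refine ⟨v, ?_⟩
        rw [LinearMap.coe_mk, AddHom.coe_mk, ← sub_eq_zero]
        set t := hJ.realSection v - s with ht
        have h0 : (t : P1 → Cplx V) (chart0 0) = 0 := by
          rw [ht, Submodule.coe_sub, Pi.sub_apply, realSection_apply, ← hv, map_add,
            proj10_of_mem_T10 ha, proj10_of_mem_T01 (cconj_mem_T01.2 ha), add_zero, sub_self]
        have hi : (t : P1 → Cplx V) OnePoint.infty = 0 := by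
          rw [← antipode_zero, ← t.2.2 (chart0 0), h0, map_zero]
        exact Subtype.ext (funext (hJ.eq_zero_of_vanishing t.2.1 h0 hi)))

theorem realSectionEquiv_apply (v : V) (p : P1) :
    (hJ.realSectionEquiv v : P1 → Cplx V) p = proj10 (J p) (incl v) := rfl

theorem coord_realSectionEquiv (v : V) (z : ℂ) : coord J (hJ.realSectionEquiv v) z =
    proj10 (J (chart0 0)) (incl v) -
      z • cext (J (chart0 Complex.I)) (cconj (proj10 (J (chart0 0)) (incl v))) :=
  hJ.coord_realSection v z

/-- The antilinear operator `a ↦ J₁ ā` on the vectors of type `(1,0)`. -/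
def quatOp : T10 (J (chart0 0)) →ₛₗ[starRingEnd ℂ] T10 (J (chart0 0)) where
  toFun a := ⟨cext (J (chart0 Complex.I)) (cconj (a : Cplx V)),
    hJ.J₁_mem_T10 (cconj_mem_T01.2 a.2)⟩
  map_add' a b := Subtype.ext (by simp)
  map_smul' c a := Subtype.ext (by simp [cconj_smul])

theorem coe_quatOp (a : T10 (J (chart0 0))) :
    (hJ.quatOp a : Cplx V) = cext (J (chart0 Complex.I)) (cconj (a : Cplx V)) := rfl

theorem isQuaternionicOperator_quatOp : IsQuaternionicOperator J hJ.quatOp where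
  sq a := Subtype.ext (by
    rw [coe_quatOp, coe_quatOp, ← cext_cconj, cconj_cconj, cext_sq hJ.sq₁]
    rfl)
  sections v := by
    constructor
    · rintro ⟨s, hs, hv⟩
      obtain ⟨u, hu⟩ := hJ.realSectionEquiv.surjective ⟨s, hs⟩
      refine ⟨⟨proj10 (J (chart0 0)) (incl u), proj10_mem hJ.sq₃ _⟩, fun z => ?_⟩
      rw [← hv z, coe_quatOp, ← hJ.coord_realSectionEquiv, hu]
    · rintro ⟨a, ha⟩
      obtain ⟨u, hu⟩ := exists_incl_of_cconj (x := (a : Cplx V) + cconj (a : Cplx V))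
        (by rw [map_add, cconj_cconj, add_comm])
      have hau : proj10 (J (chart0 0)) (incl u) = a := by
        rw [← hu, map_add, proj10_of_mem_T10 a.2, proj10_of_mem_T01 (cconj_mem_T01.2 a.2),
          add_zero]
      exact ⟨_, (hJ.realSectionEquiv u).2, fun z => by
        rw [ha, coord_realSectionEquiv, hau, coe_quatOp]⟩

omit hJ in
-- The function `a - ζ ja` determines `a` at `ζ = 0` and then `ja` at `ζ = 1`.
theorem quaternionicOperator_unique
    {j j' : T10 (J (chart0 0)) →ₛₗ[starRingEnd ℂ] T10 (J (chart0 0))}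
    (hj : IsQuaternionicOperator J j) (hj' : IsQuaternionicOperator J j') : j' = j := by
  refine LinearMap.ext fun a => Subtype.ext ?_
  obtain ⟨a', ha'⟩ := (hj'.sections _).1 ((hj.sections _).2 ⟨a, fun z => rfl⟩)
  have h0 := ha' 0
  rw [zero_smul, zero_smul, sub_zero, sub_zero] at h0
  have h1 := ha' 1
  rw [one_smul, one_smul, ← Subtype.ext h0] at h1
  exact (sub_right_injective h1).symm

/-- All `(1,0)`-spaces have half the real dimension of `V`, so an injective map between them carries
a basis to a basis. -/
theorem frame_of_injective [FiniteDimensional ℝ V] {p : P1} (L : T10 (J (chart0 0)) →ₗ[ℂ] Cplx V)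
    (hL : ∀ a, L a = 0 → a = 0) (hr : ∀ a, L a ∈ T10 (J p)) {n : ℕ}
    (b : Module.Basis (Fin n) ℂ (T10 (J (chart0 0)))) :
    LinearIndependent ℂ (fun k => L (b k)) ∧
      Submodule.span ℂ (Set.range fun k => L (b k)) = T10 (J p) := by
  have hinj : Function.Injective L := (injective_iff_map_eq_zero L).2 hL
  refine ⟨b.linearIndependent.map' L (LinearMap.ker_eq_bot.2 hinj), ?_⟩
  have h1 : Submodule.span ℂ (Set.range fun k => L (b k)) = LinearMap.range L := by
    rw [LinearMap.range_eq_map, ← b.span_eq, Submodule.map_span, ← Set.range_comp]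
    rfl
  rw [h1]
  refine Submodule.eq_of_le_of_finrank_eq ?_ ?_
  · rintro _ ⟨a, rfl⟩
    exact hr a
  · rw [LinearMap.finrank_range_of_inj hinj]
    have h2 := two_mul_finrank_T10 (hJ.sq (chart0 0))
    have h3 := two_mul_finrank_T10 (hJ.sq p)
    omega

/-- The normal bundle is a sum of copies of `𝒪(1)`. -/
theorem normalBundleIsoO1 [FiniteDimensional ℝ V] {n : ℕ}
    (hn : Module.finrank ℂ (T10 (J (chart0 0))) = n) : NormalBundleIsoO1 J n := by
  let b := Module.finBasisOfFinrankEq ℂ (T10 (J (chart0 0))) hn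
  -- The frames come from the constant vectors `b` and `J₁b`. Since `J₁b - zb` has type `(0,1)` over
  -- `z`, their `(1,0)`-parts differ by the factor `z`.
  refine ⟨fun k p => proj10 (J p) (b k),
    fun k p => proj10 (J p) (cext (J (chart0 Complex.I)) (b k)),
    fun k => hJ.isHolSection_proj10 _ _, fun k => hJ.isHolSection_proj10 _ _, fun p hp => ?_,
    fun p hp => ?_, fun k z _ => ?_⟩
  · refine hJ.frame_of_injective (proj10 (J p) ∘ₗ (T10 (J (chart0 0))).subtype) (fun a ha => ?_)
      (fun a => proj10_mem (hJ.sq p) _) b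
    obtain ⟨z, rfl⟩ := (infty_or_chart0 p).resolve_left hp
    exact Subtype.ext (hJ.T01_inf_T10_zero a.2 ((proj10_eq_zero_iff (hJ.sq _)).1 ha))
  · refine hJ.frame_of_injective (proj10 (J p) ∘ₗ cext (J (chart0 Complex.I)) ∘ₗ
      (T10 (J (chart0 0))).subtype) (fun a ha => ?_) (fun a => proj10_mem (hJ.sq p) _) b
    have h := hJ.T01_inf_T01_zero hp (hJ.J₁_mem_T01 a.2) ((proj10_eq_zero_iff (hJ.sq _)).1 ha)
    have h2 := cext_sq hJ.sq₁ (a : Cplx V)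
    rw [h, map_zero] at h2
    exact Subtype.ext (neg_eq_zero.1 h2.symm)
  · have h := proj10_of_mem_T01 (hJ.J₁_sub_mem_T01 (b k).2 z)
    rw [map_sub, map_smul, sub_eq_zero] at h
    exact h

end IsQuatFamily

end TwistorLineSections

/-! ### The hyper-Kähler structure at a point -/

section PointwiseStructure

variable {V : Type*} [AddCommGroup V] [Module ℝ V]

/-- The twisted family of forms at a point, with parameter in the sphere. -/
def pointForm (B : V →ₗ[ℝ] V →ₗ[ℝ] ℂ) (W : V →ₗ[ℝ] V →ₗ[ℝ] ℝ) (p : P1) : V →ₗ[ℝ] V →ₗ[ℝ] ℂ :=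
  OnePoint.elim p (conjForm B) (fun z => if z = 0 then B else twistForm B W z)

theorem pointForm_infty (B : V →ₗ[ℝ] V →ₗ[ℝ] ℂ) (W : V →ₗ[ℝ] V →ₗ[ℝ] ℝ) :
    pointForm B W OnePoint.infty = conjForm B := rfl

theorem pointForm_zero (B : V →ₗ[ℝ] V →ₗ[ℝ] ℂ) (W : V →ₗ[ℝ] V →ₗ[ℝ] ℝ) :
    pointForm B W (chart0 0) = B := if_pos rfl

theorem pointForm_of_ne (B : V →ₗ[ℝ] V →ₗ[ℝ] ℂ) (W : V →ₗ[ℝ] V →ₗ[ℝ] ℝ) {z : ℂ} (hz : z ≠ 0) :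
    pointForm B W (chart0 z) = twistForm B W z := if_neg hz

/-- The family of complex structures that the twisted family of forms defines. -/
def pointJ (B : V →ₗ[ℝ] V →ₗ[ℝ] ℂ) (W : V →ₗ[ℝ] V →ₗ[ℝ] ℝ) (p : P1) : V →ₗ[ℝ] V :=
  assocJ (pointForm B W p)

/-- The twisted family consists of holomorphic symplectic forms. -/
structure IsTwistedFamily (B : V →ₗ[ℝ] V →ₗ[ℝ] ℂ) (W : V →ₗ[ℝ] V →ₗ[ℝ] ℝ) : Prop where
  isCompl : ∀ p, IsCompl (kerForm (pointForm B W p)) (kerForm (conjForm (pointForm B W p)))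
  skew : ∀ v w, B v w = -B w v
  skewReal : ∀ v w, W v w = -W w v

/-- Relations free of the denominator `1 + |z|²`; they are all that the comparison of `J^(z)` with
`ϖ(z)` needs. -/
theorem sphereVec_relations (z : ℂ) :
    z * ((sphereVec (chart0 z) 0 : ℂ) - Complex.I * sphereVec (chart0 z) 1) =
      Complex.I * (1 - sphereVec (chart0 z) 2) ∧
    (sphereVec (chart0 z) 0 : ℂ) + Complex.I * sphereVec (chart0 z) 1 =
      -(Complex.I * z * (1 + sphereVec (chart0 z) 2)) := by
  rw [sphereVec_chart0]
  simp only [Matrix.cons_val]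
  have h : (1 + (‖z‖ : ℂ) ^ 2) ≠ 0 := by exact_mod_cast one_add_sq_ne z
  have hn : (‖z‖ : ℂ) ^ 2 = (z.re : ℂ) ^ 2 + (z.im : ℂ) ^ 2 := by exact_mod_cast sq_norm_eq z
  have hz : z = z.re + z.im * Complex.I := (Complex.re_add_im z).symm
  have hI := Complex.I_sq
  push_cast
  generalize (z.re : ℂ) = x at *
  generalize (z.im : ℂ) = y at *
  subst hz
  constructor
  · field_simp
    rw [hn]
    grind
  · field_simp
    rw [hn]
    grind

/-- The numbers `a, b, c, d` stand for `Re B(·, w)` at `v, Iv, Kv, KIv`; the identity then says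
`ϖ(z)(Lv, w) = i ϖ(z)(v, w)` for `L = c₀KI + c₁K + c₂I`. -/
theorem twist_relation {z c₀ c₁ c₂ : ℂ} (hz : z ≠ 0)
    (e₁ : z * (c₀ - Complex.I * c₁) = Complex.I * (1 - c₂))
    (e₂ : c₀ + Complex.I * c₁ = -(Complex.I * z * (1 + c₂))) (a b c d : ℂ) :
    -(Complex.I / (2 * z)) *
        ((c₀ * d + c₁ * c + c₂ * b) - Complex.I * (c₀ * c - c₁ * d - c₂ * a)) +
      (c₂ * d - c₀ * b - c₁ * a) - Complex.I / 2 * z *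
        ((c₀ * d + c₁ * c + c₂ * b) - -Complex.I * (c₀ * c - c₁ * d - c₂ * a)) =
    Complex.I * (-(Complex.I / (2 * z)) * (a - Complex.I * b) + c -
      Complex.I / 2 * z * (a - -Complex.I * b)) := by
  have hI := Complex.I_sq
  field_simp
  grind

namespace IsTwistedFamily

variable [FiniteDimensional ℝ V] {B : V →ₗ[ℝ] V →ₗ[ℝ] ℂ} {W : V →ₗ[ℝ] V →ₗ[ℝ] ℝ}
  (h : IsTwistedFamily B W)
include h

omit [FiniteDimensional ℝ V] in
theorem isCompl_zero : IsCompl (kerForm B) (kerForm (conjForm B)) := by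
  have := h.isCompl (chart0 0)
  rwa [pointForm_zero] at this

omit [FiniteDimensional ℝ V] in
theorem T01_pointJ (p : P1) : T01 (pointJ B W p) = kerForm (pointForm B W p) :=
  T01_assocJ (h.isCompl p)

omit [FiniteDimensional ℝ V] in
theorem T10_pointJ (p : P1) : T10 (pointJ B W p) = kerForm (conjForm (pointForm B W p)) :=
  T10_assocJ (h.isCompl p)

omit [FiniteDimensional ℝ V] in
theorem form_pointJ (p : P1) (v w : V) :
    pointForm B W p (pointJ B W p v) w = Complex.I * pointForm B W p v w :=
  form_assocJ (h.isCompl p) v w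

omit [FiniteDimensional ℝ V] in
theorem form_pointJ_zero (v w : V) : B (pointJ B W (chart0 0) v) w = Complex.I * B v w := by
  have := h.form_pointJ (chart0 0) v w
  rwa [pointForm_zero] at this

/-- The quaternionic structure that underlies the twisted family. -/
theorem exists_pointJ_eq : ∃ K : V →ₗ[ℝ] V, (∀ v w, W v w = (B (K v) w).re) ∧
    (∀ v, K (K v) = -v) ∧ (∀ v, K (pointJ B W (chart0 0) v) = -pointJ B W (chart0 0) (K v)) ∧
    ∀ p v, pointJ B W p v = sphereVec p 0 • K (pointJ B W (chart0 0) v) + sphereVec p 1 • K v +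
      sphereVec p 2 • pointJ B W (chart0 0) v := by
  have hB := h.isCompl_zero
  obtain ⟨K, hK⟩ := exists_reForm_eq hB h.skew W
  have h0 : pointJ B W (chart0 0) = assocJ B := by rw [pointJ, pointForm_zero]
  obtain ⟨hsq, hanti⟩ := quaternionic_of_twistForm hB h.skew hK fun z hz => by
    have := h.isCompl (chart0 z)
    rwa [pointForm_of_ne _ _ hz] at this
  rw [h0]
  refine ⟨K, hK, hsq, hanti, fun p v => ?_⟩
  set I := assocJ B
  let L : V →ₗ[ℝ] V := sphereVec p 0 • (K ∘ₗ I) + sphereVec p 1 • K + sphereVec p 2 • I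
  have hL : ∀ v, L v = sphereVec p 0 • K (I v) + sphereVec p 1 • K v + sphereVec p 2 • I v :=
    fun v => rfl
  have hII : ∀ v, I (I v) = -v := assocJ_sq hB
  have hIL : ∀ v, I (L v) = sphereVec p 0 • K v - sphereVec p 1 • K (I v) - sphereVec p 2 • v := by
    intro v
    have e : ∀ v, I (K v) = -K (I v) := fun v => by rw [hanti, neg_neg]
    rw [hL]
    simp only [map_add, map_smul, e, hII, map_neg]
    module
  have hKL : ∀ v, K (L v) = sphereVec p 2 • K (I v) - sphereVec p 0 • I v - sphereVec p 1 • v := by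
    intro v
    rw [hL]
    simp only [map_add, map_smul, hsq]
    module
  -- This expresses `B` through its real part, so that all the forms reduce to four real numbers
  -- depending on `v` and `w`.
  have hre : ∀ v w, B v w = ((B v w).re : ℂ) - Complex.I * ((B (I v) w).re : ℂ) := by
    intro v w
    rw [form_assocJ hB]
    apply Complex.ext <;> simp
  -- By uniqueness, it is enough that `L` acts as `i` in the first argument of `ϖ(p)`.
  suffices hs : ∀ v w, pointForm B W p (L v) w = Complex.I * pointForm B W p v w by
    rw [pointJ, ← eq_assocJ (h.isCompl p) hs, hL]
  intro v w
  have hBL : B (L v) w = ((sphereVec p 0 : ℂ) * (B (K (I v)) w).re +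
      sphereVec p 1 * (B (K v) w).re + sphereVec p 2 * (B (I v) w).re) - Complex.I *
      ((sphereVec p 0 : ℂ) * (B (K v) w).re - sphereVec p 1 * (B (K (I v)) w).re -
        sphereVec p 2 * (B v w).re) := by
    rw [hre, hIL, hL]
    simp only [map_add, map_sub, map_smul, LinearMap.add_apply, LinearMap.sub_apply,
      LinearMap.smul_apply, Complex.add_re, Complex.sub_re, Complex.smul_re, smul_eq_mul]
    push_cast
    ring
  have hWL : (W (L v) w : ℂ) = sphereVec p 2 * (B (K (I v)) w).re -
      sphereVec p 0 * (B (I v) w).re - sphereVec p 1 * (B v w).re := by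
    rw [hK, hKL]
    simp only [map_sub, map_smul, LinearMap.sub_apply, LinearMap.smul_apply, Complex.sub_re,
      Complex.smul_re, smul_eq_mul]
    push_cast
    ring
  have hBv := hre v w
  have hBLc := congrArg (starRingEnd ℂ) hBL
  have hBvc := congrArg (starRingEnd ℂ) hBv
  simp only [map_sub, map_add, map_mul, Complex.conj_ofReal, Complex.conj_I] at hBLc hBvc
  have hI := Complex.I_sq
  have hWv : (W v w : ℂ) = ((B (K v) w).re : ℂ) := by rw [hK]
  generalize ((B v w).re : ℂ) = a at hBv hBvc hBL hBLc hWL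
  generalize ((B (I v) w).re : ℂ) = b at hBv hBvc hBL hBLc hWL
  generalize ((B (K v) w).re : ℂ) = c at hBL hBLc hWv
  generalize ((B (K (I v)) w).re : ℂ) = d at hBL hBLc hWL
  rcases infty_or_chart0 p with rfl | ⟨z, rfl⟩
  · rw [pointForm_infty, conjForm_apply, conjForm_apply, hBLc, hBvc, sphereVec_infty]
    simp only [Matrix.cons_val]
    push_cast
    linear_combination -b * hI
  rcases eq_or_ne z 0 with rfl | hz
  · rw [pointForm_zero, hBL, hBv, sphereVec_chart0]
    simp only [Matrix.cons_val, Complex.zero_re, Complex.zero_im, norm_zero]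
    norm_num
    linear_combination b * hI
  obtain ⟨e₁, e₂⟩ := sphereVec_relations z
  rw [pointForm_of_ne _ _ hz, twistForm_apply, twistForm_apply, hBLc, hBvc, hBL, hWL, hWv, hBv]
  exact twist_relation hz e₁ e₂ _ _ _ _

theorem isQuatFamily : IsQuatFamily (pointJ B W) := by
  obtain ⟨K, hK, hsq, hanti, hJ⟩ := h.exists_pointJ_eq
  have h3 : ∀ v, pointJ B W (chart0 0) (pointJ B W (chart0 0) v) = -v :=
    assocJ_sq (h.isCompl (chart0 0))
  have h1 : ∀ v, pointJ B W (chart0 Complex.I) v = K (pointJ B W (chart0 0) v) := fun v => by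
    rw [hJ (chart0 Complex.I), show chart0 Complex.I = basePt 0 from rfl, sphereVec_basePt]
    simp
  refine ⟨fun v => ?_, h3, fun v => ?_, fun p v => ?_⟩
  · rw [h1, h1, hanti (K _), hsq, map_neg, neg_neg, h3]
  · rw [h1, h1, ← neg_eq_iff_eq_neg, ← hanti]
  · rw [hJ p v, h1, ← neg_neg (pointJ B W (chart0 0) (K _)), ← hanti, h3, map_neg, neg_neg]

/-- With `g = -ω₁(J₁·,·)` this is `ω_α = g(J_α·,·)`. It rests on `J₁² = -1`, `J₁J₂ = J₃` (where `J₃`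
acts as `i` in `ω₊`) and `J₁J₃ = -K`. -/
theorem re_basePt (α : Fin 3) (v w : V) :
    (B (pointJ B W (chart0 Complex.I) (pointJ B W (basePt α) v)) w).re =
      -(![(B v w).re, (B v w).im, W v w] α) := by
  obtain ⟨K, hK, hsq, hanti, hJ⟩ := h.exists_pointJ_eq
  have h1 : ∀ v, pointJ B W (chart0 Complex.I) v = K (pointJ B W (chart0 0) v) := fun v => by
    rw [hJ (chart0 Complex.I), show chart0 Complex.I = basePt 0 from rfl, sphereVec_basePt]
    simp
  have h2 : pointJ B W (basePt 1) v = K v := by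
    rw [hJ (basePt 1), sphereVec_basePt]
    simp
  fin_cases α
  · change (B (pointJ B W (chart0 Complex.I) (pointJ B W (chart0 Complex.I) v)) w).re = -(B v w).re
    rw [h.isQuatFamily.sq₁]
    simp
  · change (B (pointJ B W (chart0 Complex.I) (pointJ B W (basePt 1) v)) w).re = -(B v w).im
    rw [h2, h1, hanti, hsq, map_neg (pointJ B W _), neg_neg, h.form_pointJ_zero]
    simp
  · change (B (pointJ B W (chart0 Complex.I) (pointJ B W (chart0 0) v)) w).re = -W v w
    rw [h1, h.isQuatFamily.sq₃, hK]
    simp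

/-- The form `ω₁ (J₁ v, w)`, which is `-g (v, w)`, is symmetric. -/
theorem re_J₁_symm (v w : V) : (B (pointJ B W (chart0 Complex.I) v) w).re =
    (B (pointJ B W (chart0 Complex.I) w) v).re := by
  have hq := h.isQuatFamily
  have key : ∀ v w, (B (pointJ B W (chart0 Complex.I) v) w).re = W (pointJ B W (chart0 0) v) w := by
    intro v w
    have h2 := h.re_basePt 2 (pointJ B W (chart0 0) v) w
    change (B (pointJ B W (chart0 Complex.I)
      (pointJ B W (chart0 0) (pointJ B W (chart0 0) v))) w).re = -W _ w at h2
    rw [hq.sq₃, map_neg, map_neg, LinearMap.neg_apply, Complex.neg_re, neg_inj] at h2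
    exact h2
  -- By skewness `J₃` acts as `i` in either argument of `ω₊`, so it moves across.
  have hB : ∀ v w, B v (pointJ B W (chart0 0) w) = B (pointJ B W (chart0 0) v) w := by
    intro v w
    rw [h.skew, h.form_pointJ_zero, h.form_pointJ_zero, h.skew w v]
    ring
  have h2 := h.re_basePt 2 v (pointJ B W (chart0 0) w)
  change (B (pointJ B W (chart0 Complex.I) (pointJ B W (chart0 0) v)) _).re = -W v _ at h2
  rw [hB, hq.anti, hq.sq₃, map_neg (pointJ B W _), neg_neg] at h2
  rw [h2, h.skewReal, neg_neg, key]

/-- The left side is minus the symmetrisation of `ω₊(J₁v, w)`. The real part of that form is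
symmetric, and its imaginary part `-ω₃(v, w)` is skew and drops out; hence `g` is real. -/
theorem twist_eq (v w : V) :
    (1 / 2 : ℂ) * (B v (pointJ B W (chart0 Complex.I) w) - B (pointJ B W (chart0 Complex.I) v) w) =
      ((-(B (pointJ B W (chart0 Complex.I) v) w).re : ℝ) : ℂ) := by
  have him : ∀ v w, (B (pointJ B W (chart0 Complex.I) v) w).im = -W v w := by
    intro v w
    have h2 := h.re_basePt 2 v w
    change (B (pointJ B W (chart0 Complex.I) (pointJ B W (chart0 0) v)) w).re = -W v w at h2
    have h3 : B (pointJ B W (chart0 Complex.I) (pointJ B W (chart0 0) v)) w =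
        -(Complex.I * B (pointJ B W (chart0 Complex.I) v) w) := by
      rw [← h.form_pointJ_zero, h.isQuatFamily.anti, map_neg, LinearMap.neg_apply, neg_neg]
    rw [h3] at h2
    simpa using h2
  have hre := h.re_J₁_symm v w
  have him1 := him v w
  have him2 := him w v
  have hs := h.skewReal v w
  rw [h.skew v]
  apply Complex.ext
  · simp
    linarith
  · simp
    linarith

end IsTwistedFamily

/-! ### The Hitchin--Karlhede--Lindström--Roček structure -/

section HKLR

variable {J : P1 → V →ₗ[ℝ] V} (hJ : IsQuatFamily J) {ϖ : P1 → V →ₗ[ℝ] V →ₗ[ℝ] ℂ}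

theorem cform_skew {B : V →ₗ[ℝ] V →ₗ[ℝ] ℂ} (h : ∀ v w, B v w = -B w v) (x y : Cplx V) :
    cform B x y = -cform B y x := by
  have e : cform B = -(cform B).flip := clinear_ext₂ fun v w => by
    rw [cform_incl, LinearMap.neg_apply, LinearMap.neg_apply, LinearMap.flip_apply, cform_incl, h]
  exact LinearMap.congr_fun (LinearMap.congr_fun e x) y

/-- The discarded `(0,1)`-parts lie in the kernel of `B`, in the first argument directly and in the
second by skewness. -/
theorem cform_proj10 {B : V →ₗ[ℝ] V →ₗ[ℝ] ℂ} (h : ∀ v w, B v w = -B w v) {I : V →ₗ[ℝ] V}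
    (hI : ∀ v, I (I v) = -v) (hk : T01 I = kerForm B) (x y : Cplx V) :
    cform B (proj10 I x) (proj10 I y) = cform B x y := by
  have h1 : ∀ x y, cform B (proj10 I x) y = cform B x y := by
    intro x y
    have h2 : x - proj10 I x ∈ kerForm B := hk ▸ sub_proj10_mem hI x
    rw [kerForm, LinearMap.mem_ker, map_sub, sub_eq_zero] at h2
    rw [h2]
  rw [h1, cform_skew h, h1, ← cform_skew h]

include hJ in
/-- The Hitchin--Karlhede--Lindström--Roček structure exists, is unique, and is identified with the
given one. -/
theorem exists_isHKLR (g : V →ₗ[ℝ] V →ₗ[ℝ] ℝ) (om : Fin 3 → V →ₗ[ℝ] V →ₗ[ℝ] ℝ)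
    (hskew : ∀ p v w, ϖ p v w = -ϖ p w v) (hker : ∀ p, T01 (J p) = kerForm (ϖ p))
    (hg : ∀ v w, (g v w : ℂ) = (1 / 2) * (ϖ (chart0 0) v (J (chart0 Complex.I) w) -
      ϖ (chart0 0) (J (chart0 Complex.I) v) w))
    (hom : ∀ α v w, om α v w = g (J (basePt α) v) w) :
    ∃ S : TangentData (realHolSections J),
      (IsHKLR J ϖ hJ.quatOp S ∧ ∀ S', IsHKLR J ϖ hJ.quatOp S' → S' = S) ∧
      (∀ v w, S.metric (hJ.realSectionEquiv v) (hJ.realSectionEquiv w) = g v w) ∧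
      (∀ p v, S.cplx p (hJ.realSectionEquiv v) = hJ.realSectionEquiv (J p v)) ∧
      (∀ p v w, S.symp p (hJ.realSectionEquiv v) (hJ.realSectionEquiv w) = ϖ p v w) ∧
      (∀ α v w, S.kahler α (hJ.realSectionEquiv v) (hJ.realSectionEquiv w) = om α v w) := by
  let Φ := hJ.realSectionEquiv
  let Ψ : realHolSections J →ₗ[ℝ] V := Φ.symm.toLinearMap
  have hΨ : ∀ v, Ψ (Φ v) = v := Φ.symm_apply_apply
  -- The structure of `V`, transported through `Φ`; it remains to see that it has the intrinsic
  -- description.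
  let S : TangentData (realHolSections J) :=
    { metric := g.compl₁₂ Ψ Ψ
      cplx := fun p => Φ.toLinearMap ∘ₗ J p ∘ₗ Ψ
      symp := fun p => (ϖ p).compl₁₂ Ψ Ψ
      kahler := fun α => (om α).compl₁₂ Ψ Ψ }
  have hm : ∀ v w, S.metric (Φ v) (Φ w) = g v w := fun v w => by
    simp only [S, LinearMap.compl₁₂_apply, hΨ]
  have hc : ∀ p v, S.cplx p (Φ v) = Φ (J p v) := fun p v => by
    simp only [S, LinearMap.comp_apply, hΨ, LinearEquiv.coe_coe]
  have hs : ∀ p v w, S.symp p (Φ v) (Φ w) = ϖ p v w := fun p v w => by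
    simp only [S, LinearMap.compl₁₂_apply, hΨ]
  have hk : ∀ α v w, S.kahler α (Φ v) (Φ w) = om α v w := fun α v w => by
    simp only [S, LinearMap.compl₁₂_apply, hΨ]
  have hJp : ∀ p v, proj10 (J p) (incl (J p v)) = Complex.I • proj10 (J p) (incl v) := by
    intro p v
    rw [proj10_apply, cext_incl, hJ.sq, proj10_apply, cext_incl, map_neg, smul_comm Complex.I,
      smul_sub Complex.I, smul_smul Complex.I, Complex.I_mul_I]
    module
  have hS : IsHKLR J ϖ hJ.quatOp S := by
    refine ⟨fun a b s t has hbt => ?_, fun p s => ?_, fun p s t => ?_, fun α s t => ?_⟩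
    · obtain ⟨v, rfl⟩ := Φ.surjective s
      obtain ⟨w, rfl⟩ := Φ.surjective t
      have ha : proj10 (J (chart0 0)) (incl v) = a := by
        simpa using (hJ.coord_realSectionEquiv v 0).symm.trans (has 0)
      have hb : proj10 (J (chart0 0)) (incl w) = b := by
        simpa using (hJ.coord_realSectionEquiv w 0).symm.trans (hbt 0)
      -- `J₁` exchanges the types, so the `(1,0)`-part of `J₁u` is `j` of the `(1,0)`-part of `u`.
      -- The coordinate formula for `G` thereby becomes that for `g`.
      have hJ1 : ∀ u, proj10 (J (chart0 0)) (incl (J (chart0 Complex.I) u)) =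
          cext (J (chart0 Complex.I)) (cconj (proj10 (J (chart0 0)) (incl u))) := by
        intro u
        have h10 : proj10 (J (chart0 0)) (incl u) ∈ T10 (J (chart0 0)) := proj10_mem hJ.sq₃ _
        rw [← cext_incl]
        conv_lhs => rw [← proj10_incl_add_cconj (J := J (chart0 0)) u]
        rw [map_add, map_add, proj10_of_mem_T01 (hJ.J₁_mem_T01 h10),
          proj10_of_mem_T10 (hJ.J₁_mem_T10 (cconj_mem_T01.2 h10)), zero_add]
      rw [hm, hg, hJ.coe_quatOp, hJ.coe_quatOp, ← ha, ← hb, ← hJ1, ← hJ1,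
        cform_proj10 (hskew _) hJ.sq₃ (hker _), cform_proj10 (hskew _) hJ.sq₃ (hker _), cform_incl,
        cform_incl]
    · obtain ⟨v, rfl⟩ := Φ.surjective s
      rw [hc]
      exact hJp p v
    · obtain ⟨v, rfl⟩ := Φ.surjective s
      obtain ⟨w, rfl⟩ := Φ.surjective t
      rw [hs]
      refine (cform_incl (ϖ p) v w).symm.trans ?_
      exact (cform_proj10 (hskew p) (hJ.sq p) (hker p) _ _).symm
    · obtain ⟨v, rfl⟩ := Φ.surjective s
      obtain ⟨w, rfl⟩ := Φ.surjective t
      rw [hk, hom, hc, hm]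
  refine ⟨S, ⟨hS, fun S' hS' => ?_⟩, hm, hc, hs, hk⟩
  have hm' : S'.metric = S.metric := by
    refine LinearMap.ext fun s => LinearMap.ext fun t => ?_
    obtain ⟨v, rfl⟩ := Φ.surjective s
    obtain ⟨w, rfl⟩ := Φ.surjective t
    have e : ∀ S'', IsHKLR J ϖ hJ.quatOp S'' → _ := fun S'' h =>
      h.metric_eq ⟨_, proj10_mem hJ.sq₃ (incl v)⟩ ⟨_, proj10_mem hJ.sq₃ (incl w)⟩ (Φ v) (Φ w)
        (hJ.coord_realSectionEquiv v) (hJ.coord_realSectionEquiv w)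
    exact Complex.ofReal_injective ((e S' hS').trans (e S hS).symm)
  have hc' : S'.cplx = S.cplx := by
    refine funext fun p => LinearMap.ext fun s => ?_
    have e := (hS'.cplx_eq p s).trans (hS.cplx_eq p s).symm
    -- Evaluation at `p` is injective on real sections: a real vector is determined by its
    -- `(1,0)`-part for `J p`. Hence the value at `p` fixes the endomorphism.
    obtain ⟨v, hv⟩ := Φ.surjective (S'.cplx p s)
    obtain ⟨w, hw⟩ := Φ.surjective (S.cplx p s)
    rw [← hv, ← hw] at e ⊢
    rw [proj10_incl_injective e]
  have hs' : S'.symp = S.symp := by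
    refine funext fun p => LinearMap.ext fun s => LinearMap.ext fun t => ?_
    rw [hS'.symp_eq, hS.symp_eq]
  have hk' : S'.kahler = S.kahler := by
    refine funext fun α => LinearMap.ext fun s => LinearMap.ext fun t => ?_
    rw [hS'.kahler_eq, hS.kahler_eq, hm', hc']
  cases S'
  simp only [TangentData.mk.injEq, S]
  exact ⟨hm', hc', hs', hk'⟩

end HKLR


end PointwiseStructure

/-! ### Smooth fields in local frames -/

section SmoothFields

open Filter Topology

variable {E : Type*} [NormedAddCommGroup E] [NormedSpace ℝ E]
  {M : Type*} [TopologicalSpace M] [ChartedSpace E M] [IsManifold 𝓘(ℝ, E) ∞ M]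
  {F : Type*} [NormedAddCommGroup F] [NormedSpace ℝ F]
  {G : Type*} [NormedAddCommGroup G] [NormedSpace ℝ G]

/-- The local frame of the tangent bundle near `x₀`. -/
def frame (x₀ x : M) : E →L[ℝ] TangentSpace 𝓘(ℝ, E) x :=
  (trivializationAt E (TangentSpace 𝓘(ℝ, E)) x₀).symmL ℝ x

theorem eventually_mem_baseSet (x₀ : M) : ∀ᶠ x in 𝓝 x₀,
    x ∈ (trivializationAt E (TangentSpace 𝓘(ℝ, E)) x₀).baseSet :=
  (trivializationAt E (TangentSpace 𝓘(ℝ, E)) x₀).open_baseSet.mem_nhds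
    (FiberBundle.mem_baseSet_trivializationAt' x₀)

theorem frame_bijective (x₀ : M) :
    ∀ᶠ x in 𝓝 x₀, Function.Bijective (frame (E := E) x₀ x) := by
  filter_upwards [eventually_mem_baseSet (E := E) x₀] with x hx
  refine ⟨Function.LeftInverse.injective (g := (trivializationAt E (TangentSpace 𝓘(ℝ, E))
    x₀).continuousLinearMapAt ℝ x) fun v => ?_, fun v => ⟨(trivializationAt E
    (TangentSpace 𝓘(ℝ, E)) x₀).continuousLinearMapAt ℝ x v, ?_⟩⟩
  · exact Bundle.Trivialization.continuousLinearMapAt_symmL _ hx v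
  · exact Bundle.Trivialization.symmL_continuousLinearMapAt _ hx v

/-- Smoothness of a field of bilinear forms in terms of its components. -/
theorem smoothBil_iff {B : BilField E M F} : SmoothBil B ↔ ∀ x₀ : M,
    ∃ b : M → E →L[ℝ] E →L[ℝ] F, ContMDiffAt 𝓘(ℝ, E) 𝓘(ℝ, E →L[ℝ] E →L[ℝ] F) ∞ b x₀ ∧
      ∀ᶠ x in 𝓝 x₀, ∀ v w, b x v w = B x (frame x₀ x v) (frame x₀ x w) := by
  refine forall_congr' fun x₀ => ?_
  rw [contMDiffAt_hom_bundle]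
  have key : ∀ᶠ x in 𝓝 x₀, ∀ v w, ContinuousLinearMap.inCoordinates E (TangentSpace 𝓘(ℝ, E))
      (E →L[ℝ] F) (fun x : M => TangentSpace 𝓘(ℝ, E) x →L[ℝ] Bundle.Trivial M F x) x₀ x x₀ x (B x)
      v w = B x (frame x₀ x v) (frame x₀ x w) := by
    filter_upwards [eventually_mem_baseSet (E := E) x₀] with x hx v w
    rw [inCoordinates_apply_eq₂ hx hx (by trivial)]
    simp [frame, Bundle.Trivialization.symmL_apply _ hx]
  constructor
  · rintro ⟨-, h⟩
    exact ⟨_, h, key⟩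
  · rintro ⟨b, hb, h⟩
    refine ⟨contMDiffAt_id, hb.congr_of_eventuallyEq ?_⟩
    filter_upwards [key, h] with x h1 h2
    ext v w
    exact (h1 v w).trans (h2 v w).symm

/-- Smooth fields of endomorphisms. -/
def SmoothEnd (J : EndField E M) : Prop :=
  ContMDiff 𝓘(ℝ, E) (𝓘(ℝ, E).prod 𝓘(ℝ, E →L[ℝ] E)) ∞
    (fun x => Bundle.TotalSpace.mk' (E →L[ℝ] E)
      (E := fun x : M => TangentSpace 𝓘(ℝ, E) x →L[ℝ] TangentSpace 𝓘(ℝ, E) x) x (J x))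

theorem smoothEnd_iff {J : EndField E M} : SmoothEnd J ↔ ∀ x₀ : M,
    ∃ j : M → E →L[ℝ] E, ContMDiffAt 𝓘(ℝ, E) 𝓘(ℝ, E →L[ℝ] E) ∞ j x₀ ∧
      ∀ᶠ x in 𝓝 x₀, ∀ v, frame x₀ x (j x v) = J x (frame x₀ x v) := by
  refine forall_congr' fun x₀ => ?_
  rw [contMDiffAt_hom_bundle]
  have key : ∀ᶠ x in 𝓝 x₀, ∀ v, frame x₀ x (ContinuousLinearMap.inCoordinates E
      (TangentSpace 𝓘(ℝ, E)) E (TangentSpace 𝓘(ℝ, E)) x₀ x x₀ x (J x) v) =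
      J x (frame x₀ x v) := by
    filter_upwards [eventually_mem_baseSet (E := E) x₀] with x hx v
    exact Bundle.Trivialization.symmL_continuousLinearMapAt _ hx _
  constructor
  · rintro ⟨-, h⟩
    exact ⟨_, h, key⟩
  · rintro ⟨b, hb, h⟩
    refine ⟨contMDiffAt_id, hb.congr_of_eventuallyEq ?_⟩
    filter_upwards [key, h, frame_bijective (E := E) x₀] with x h1 h2 h3
    ext v
    exact h3.1 ((h1 v).trans (h2 v).symm)

theorem SmoothBil.map {B : BilField E M F} (hB : SmoothBil B) (L : F →L[ℝ] G) {C : BilField E M G}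
    (hC : ∀ x v w, C x v w = L (B x v w)) : SmoothBil C := by
  rw [smoothBil_iff] at hB ⊢
  intro x₀
  obtain ⟨b, hb, h⟩ := hB x₀
  refine ⟨fun x => (ContinuousLinearMap.postcomp E L).comp (b x), contMDiffAt_const.clm_comp hb, ?_⟩
  filter_upwards [h] with x hx v w
  rw [hC, ← hx]
  rfl

theorem SmoothBil.add {B C D : BilField E M F} (hB : SmoothBil B) (hC : SmoothBil C)
    (hD : ∀ x v w, D x v w = B x v w + C x v w) : SmoothBil D := by
  rw [smoothBil_iff] at hB hC ⊢
  intro x₀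
  obtain ⟨b, hb, h⟩ := hB x₀
  obtain ⟨c, hc, h'⟩ := hC x₀
  refine ⟨fun x => b x + c x, hb.add hc, ?_⟩
  filter_upwards [h, h'] with x hx hx' v w
  rw [hD, ← hx, ← hx']
  rfl

theorem SmoothBil.comp_end {B C : BilField E M F} {J : EndField E M} (hB : SmoothBil B)
    (hJ : SmoothEnd J) (hC : ∀ x v w, C x v w = B x (J x v) w) : SmoothBil C := by
  rw [smoothBil_iff] at hB ⊢
  rw [smoothEnd_iff] at hJ
  intro x₀
  obtain ⟨b, hb, h⟩ := hB x₀
  obtain ⟨j, hj, h'⟩ := hJ x₀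
  refine ⟨fun x => (b x).comp (j x), hb.clm_comp hj, ?_⟩
  filter_upwards [h, h'] with x hx hx' v w
  rw [hC, ← hx', ← hx]
  rfl

theorem SmoothEnd.comp {J K L : EndField E M} (hJ : SmoothEnd J) (hK : SmoothEnd K)
    (hL : ∀ x v, L x v = J x (K x v)) : SmoothEnd L := by
  rw [smoothEnd_iff] at hJ hK ⊢
  intro x₀
  obtain ⟨j, hj, h⟩ := hJ x₀
  obtain ⟨k, hk, h'⟩ := hK x₀
  refine ⟨fun x => (j x).comp (k x), hj.clm_comp hk, ?_⟩
  filter_upwards [h, h'] with x hx hx' v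
  rw [hL, ← hx', ← hx]
  rfl

theorem SmoothEnd.add {J K L : EndField E M} (hJ : SmoothEnd J) (hK : SmoothEnd K)
    (hL : ∀ x v, L x v = J x v + K x v) : SmoothEnd L := by
  rw [smoothEnd_iff] at hJ hK ⊢
  intro x₀
  obtain ⟨j, hj, h⟩ := hJ x₀
  obtain ⟨k, hk, h'⟩ := hK x₀
  refine ⟨fun x => j x + k x, hj.add hk, ?_⟩
  filter_upwards [h, h'] with x hx hx' v
  rw [hL, ← hx, ← hx', ← map_add]
  rfl

theorem SmoothEnd.smul {J L : EndField E M} (hJ : SmoothEnd J) (c : ℝ)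
    (hL : ∀ x v, L x v = c • J x v) : SmoothEnd L := by
  rw [smoothEnd_iff] at hJ ⊢
  intro x₀
  obtain ⟨j, hj, h⟩ := hJ x₀
  refine ⟨fun x => (c • ContinuousLinearMap.id ℝ E).comp (j x), contMDiffAt_const.clm_comp hj, ?_⟩
  filter_upwards [h] with x hx v
  rw [hL, ← hx, ← map_smul]
  rfl

/-- An endomorphism that relates two smooth forms, the first of them nondegenerate, is smooth. -/
theorem SmoothBil.smoothEnd [FiniteDimensional ℝ E] {A C : BilField E M ℝ} {J : EndField E M}
    (hA : SmoothBil A) (hC : SmoothBil C)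
    (hnd : ∀ (x : M) (v : TangentSpace 𝓘(ℝ, E) x), (∀ w, A x v w = 0) → v = 0)
    (hJ : ∀ x v w, A x (J x v) w = C x v w) : SmoothEnd J := by
  rw [smoothBil_iff] at hA hC
  rw [smoothEnd_iff]
  intro x₀
  obtain ⟨a, ha, ha'⟩ := hA x₀
  obtain ⟨c, hc, hc'⟩ := hC x₀
  have hinj : ∀ᶠ x in 𝓝 x₀, Function.Injective (a x) := by
    filter_upwards [ha', frame_bijective (E := E) x₀] with x hx hb
    rw [injective_iff_map_eq_zero]
    intro v hv
    have : frame x₀ x v = 0 := by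
      refine hnd x _ fun w => ?_
      obtain ⟨w, rfl⟩ := hb.2 w
      rw [← hx, hv]
      rfl
    exact hb.1 (this.trans (map_zero _).symm)
  have hequiv : ∀ᶠ x in 𝓝 x₀, ∃ e : E ≃L[ℝ] (E →L[ℝ] ℝ), (e : E →L[ℝ] (E →L[ℝ] ℝ)) = a x := by
    filter_upwards [hinj] with x hx
    have hfin : Module.finrank ℝ E = Module.finrank ℝ (E →L[ℝ] ℝ) :=
      Subspace.dual_finrank_eq.symm.trans
        (LinearMap.toContinuousLinearMap (𝕜 := ℝ) (E := E) (F' := ℝ)).finrank_eq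
    exact ⟨(LinearEquiv.ofInjectiveOfFinrankEq (a x).toLinearMap hx hfin).toContinuousLinearEquiv,
      rfl⟩
  -- In the frame, `J` has components `a⁻¹c`, and inversion is smooth at invertible operators.
  refine ⟨fun x => (ContinuousLinearMap.inverse (a x)).comp (c x), ?_, ?_⟩
  · refine ContMDiffAt.clm_comp ?_ hc
    obtain ⟨e, he⟩ := hequiv.self_of_nhds
    have h1 : ContDiffAt ℝ ∞ ContinuousLinearMap.inverse (a x₀) := he ▸ contDiffAt_map_inverse e
    exact h1.contMDiffAt.comp x₀ ha
  · filter_upwards [ha', hc', hequiv, frame_bijective (E := E) x₀] with x h1 h2 ⟨e, he⟩ hb v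
    rw [← sub_eq_zero]
    refine hnd x _ fun w => ?_
    obtain ⟨w, rfl⟩ := hb.2 w
    rw [map_sub, sub_apply, hJ, ← h2, ← h1, ← he,
      ContinuousLinearMap.inverse_equiv, sub_eq_zero]
    have : e (e.symm (c x v)) = c x v := e.apply_symm_apply _
    exact congrArg (fun f : E →L[ℝ] ℝ => f w) this

end SmoothFields

/-! ### Closed forms and integrability -/

section ClosedForms

open Filter Topology

variable {E : Type*} [NormedAddCommGroup E] [NormedSpace ℝ E]
  {M : Type*} [TopologicalSpace M] [ChartedSpace E M] [IsManifold 𝓘(ℝ, E) ∞ M]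
  {F : Type*} [NormedAddCommGroup F] [NormedSpace ℝ F]
  {G : Type*} [NormedAddCommGroup G] [NormedSpace ℝ G]

theorem SmoothBil.mdifferentiableAt {B : BilField E M F} (hB : SmoothBil B)
    {Y Z : ∀ x : M, TangentSpace 𝓘(ℝ, E) x} {x : M} (hY : SmoothVecAt Y x)
    (hZ : SmoothVecAt Z x) :
    MDifferentiableAt 𝓘(ℝ, E) 𝓘(ℝ, F) (fun y => B y (Y y) (Z y)) x := by
  have h : ContMDiffAt 𝓘(ℝ, E) (𝓘(ℝ, E).prod 𝓘(ℝ, F)) ∞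
      (fun y => Bundle.TotalSpace.mk' F (E := Bundle.Trivial M F) y (B y (Y y) (Z y))) x :=
    ContMDiffAt.clm_bundle_apply₂ (F₁ := E) (F₂ := E) (hB x) hY hZ
  rw [Bundle.contMDiffAt_totalSpace] at h
  exact h.2.mdifferentiableAt (by simp)

theorem dirDeriv_map {B : BilField E M F} (hB : SmoothBil B) (L : F →L[ℝ] G)
    {C : BilField E M G} {Y Z Y' Z' : ∀ x : M, TangentSpace 𝓘(ℝ, E) x} {x : M}
    (hY : SmoothVecAt Y x) (hZ : SmoothVecAt Z x)
    (h : ∀ y, C y (Y' y) (Z' y) = L (B y (Y y) (Z y))) (v : TangentSpace 𝓘(ℝ, E) x) :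
    dirDeriv C Y' Z' x v = L (dirDeriv B Y Z x v) := by
  have h1 := (L.hasMFDerivAt (x := B x (Y x) (Z x))).comp x
    (hB.mdifferentiableAt hY hZ).hasMFDerivAt
  have h2 : (fun y => C y (Y' y) (Z' y)) = L ∘ fun y => B y (Y y) (Z y) := funext h
  rw [dirDeriv, h2, h1.mfderiv]
  rfl

theorem dirDeriv_add {B C D : BilField E M F} (hB : SmoothBil B) (hC : SmoothBil C)
    {Y Z : ∀ x : M, TangentSpace 𝓘(ℝ, E) x} {x : M}
    (hY : SmoothVecAt Y x) (hZ : SmoothVecAt Z x)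
    (h : ∀ y v w, D y v w = B y v w + C y v w) (v : TangentSpace 𝓘(ℝ, E) x) :
    dirDeriv D Y Z x v = dirDeriv B Y Z x v + dirDeriv C Y Z x v := by
  have h1 := (hB.mdifferentiableAt hY hZ).hasMFDerivAt.add
    (hC.mdifferentiableAt hY hZ).hasMFDerivAt
  have h2 : (fun y => D y (Y y) (Z y)) =
      (fun y => B y (Y y) (Z y)) + fun y => C y (Y y) (Z y) := funext fun y => h y _ _
  rw [dirDeriv, h2, h1.mfderiv]
  rfl

/-- Closed 2-forms. -/
structure IsClosedTwoForm (B : BilField E M F) : Prop where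
  twoForm : IsTwoForm B
  closed : IsClosedForm B

theorem IsClosedTwoForm.map {B : BilField E M F} (hB : IsClosedTwoForm B) (L : F →L[ℝ] G)
    {C : BilField E M G} (hC : ∀ x v w, C x v w = L (B x v w)) : IsClosedTwoForm C := by
  refine ⟨⟨hB.twoForm.1.map L hC, fun x v => by rw [hC, hB.twoForm.2, map_zero]⟩,
    fun x X Y Z hX hY hZ => ?_⟩
  have h := congrArg L (hB.closed x X Y Z hX hY hZ)
  rw [dirDeriv_map hB.twoForm.1 L hY hZ fun y => hC y _ _,
    dirDeriv_map hB.twoForm.1 L hX hZ fun y => hC y _ _,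
    dirDeriv_map hB.twoForm.1 L hX hY fun y => hC y _ _, hC, hC, hC]
  simpa only [map_add, map_sub, map_zero] using h

theorem IsClosedTwoForm.add {B C D : BilField E M F} (hB : IsClosedTwoForm B)
    (hC : IsClosedTwoForm C) (hD : ∀ x v w, D x v w = B x v w + C x v w) : IsClosedTwoForm D := by
  refine ⟨⟨hB.twoForm.1.add hC.twoForm.1 hD, fun x v => by
    rw [hD, hB.twoForm.2, hC.twoForm.2, add_zero]⟩, fun x X Y Z hX hY hZ => ?_⟩
  have h1 := hB.closed x X Y Z hX hY hZ
  have h2 := hC.closed x X Y Z hX hY hZ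
  have h3 := congrArg₂ (· + ·) h1 h2
  rw [dirDeriv_add hB.twoForm.1 hC.twoForm.1 hY hZ hD,
    dirDeriv_add hB.twoForm.1 hC.twoForm.1 hX hZ hD,
    dirDeriv_add hB.twoForm.1 hC.twoForm.1 hX hY hD, hD, hD, hD]
  simp only [add_zero] at h3
  rw [← h3]
  abel

theorem IsTwoForm.skew {B : BilField E M F} (hB : IsTwoForm B) (x : M)
    (v w : TangentSpace 𝓘(ℝ, E) x) : B x v w = -B x w v := by
  have h := hB.2 x (v + w)
  rw [map_add, map_add, add_apply, add_apply, hB.2, hB.2, zero_add, add_zero] at h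
  exact eq_neg_of_add_eq_zero_right h

theorem SmoothEnd.smoothVecAt {J : EndField E M} (hJ : SmoothEnd J)
    {X : ∀ x : M, TangentSpace 𝓘(ℝ, E) x} {x : M} (hX : SmoothVecAt X x) :
    SmoothVecAt (fun y => J y (X y)) x :=
  ContMDiffAt.clm_bundle_apply (F₁ := E) (F₂ := E) (hJ x) hX

/-- An almost complex structure is integrable if it is defined by a closed complex 2-form. -/
theorem IsClosedTwoForm.isComplexStructure {Ω : BilField E M ℂ} (hΩ : IsClosedTwoForm Ω)
    (hnd : ∀ (x : M) (v : TangentSpace 𝓘(ℝ, E) x), (∀ w, Ω x v w = 0) → v = 0)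
    {J : EndField E M} (hJ : SmoothEnd J) (hsq : ∀ x v, J x (J x v) = -v)
    (hΩJ : ∀ x v w, Ω x (J x v) w = Complex.I * Ω x v w) : IsComplexStructure J := by
  refine ⟨hJ, hsq, fun x X Y hX hY => hnd x _ fun w => ?_⟩
  -- Closedness is tested on vector fields, so `w` is extended to a field that is smooth at `x`.
  obtain ⟨Z, hZ, rfl⟩ : ∃ Z : ∀ x : M, TangentSpace 𝓘(ℝ, E) x, SmoothVecAt Z x ∧ Z x = w :=
    ⟨FiberBundle.extend E w, FiberBundle.contMDiffAt_extend 𝓘(ℝ, E) E w, FiberBundle.extend_apply_self E w⟩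
  have hΩJ' : ∀ x v w, Ω x v (J x w) = Complex.I * Ω x v w := fun x v w => by
    rw [hΩ.twoForm.skew, hΩJ, hΩ.twoForm.skew x w]
    ring
  have hJX := hJ.smoothVecAt hX
  have hJY := hJ.smoothVecAt hY
  let L : ℂ →L[ℝ] ℂ := Complex.I • ContinuousLinearMap.id ℝ ℂ
  have hL : ∀ z, L z = Complex.I * z := fun z => rfl
  have hd1 : ∀ {X' Y' : ∀ x : M, TangentSpace 𝓘(ℝ, E) x}, SmoothVecAt X' x → SmoothVecAt Y' x →
      ∀ v, dirDeriv Ω (fun y => J y (X' y)) Y' x v = Complex.I * dirDeriv Ω X' Y' x v := by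
    intro X' Y' hX' hY' v
    exact dirDeriv_map hΩ.twoForm.1 L hX' hY' (fun y => hΩJ y _ _) v
  have hd2 : ∀ {X' Y' : ∀ x : M, TangentSpace 𝓘(ℝ, E) x}, SmoothVecAt X' x → SmoothVecAt Y' x →
      ∀ v, dirDeriv Ω X' (fun y => J y (Y' y)) x v = Complex.I * dirDeriv Ω X' Y' x v := by
    intro X' Y' hX' hY' v
    exact dirDeriv_map hΩ.twoForm.1 L hX' hY' (fun y => hΩJ' y _ _) v
  -- In `dΩ(JX, JY, Z) - i dΩ(JX, Y, Z) - i dΩ(X, JY, Z) - dΩ(X, Y, Z)` all derivatives of functions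
  -- cancel, and so do the brackets with `Z`; what is left is `-Ω(N(X, Y), Z)`, with `N` the
  -- Nijenhuis tensor.
  have e0 := hΩ.closed x X Y Z hX hY hZ
  have e1 := hΩ.closed x _ _ Z hJX hJY hZ
  have e2 := hΩ.closed x _ Y Z hJX hY hZ
  have e3 := hΩ.closed x X _ Z hX hJY hZ
  rw [hd1 hY hZ, hd1 hX hZ, hd1 hX hJY, hd2 hX hY, hΩJ', hΩJ'] at e1
  rw [hd1 hX hZ, hd1 hX hY, hΩJ'] at e2
  rw [hd1 hY hZ, hd2 hX hY, hΩJ'] at e3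
  simp only [map_sub, sub_apply, hΩJ]
  have hI := Complex.I_sq
  grind

end ClosedForms

/-! ### The pseudo-hyper-Kähler structure on the manifold -/

section TwistedFamilyOnManifold

variable {E : Type*} [NormedAddCommGroup E] [NormedSpace ℝ E]
  {M : Type*} [TopologicalSpace M] [ChartedSpace E M] [IsManifold 𝓘(ℝ, E) ∞ M]

omit [IsManifold 𝓘(ℝ, E) ∞ M] in
theorem alg_apply {F : Type*} [NormedAddCommGroup F] [NormedSpace ℝ F] (B : BilField E M F) (x : M)
    (v w : TangentSpace 𝓘(ℝ, E) x) : alg B x v w = B x v w := rfl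

omit [IsManifold 𝓘(ℝ, E) ∞ M] in
theorem varpi_zero (ωp : BilField E M ℂ) (ω₃ : BilField E M ℝ) :
    varpi ωp ω₃ (chart0 0) = ωp := if_pos rfl

omit [IsManifold 𝓘(ℝ, E) ∞ M] in
theorem varpi_of_ne (ωp : BilField E M ℂ) (ω₃ : BilField E M ℝ) {z : ℂ} (hz : z ≠ 0) :
    varpi ωp ω₃ (chart0 z) = fun x => (-(Complex.I / (2 * z))) • ωp x +
      postField Complex.ofRealCLM ω₃ x - (Complex.I / 2 * z) • conjField ωp x := if_neg hz

omit [IsManifold 𝓘(ℝ, E) ∞ M] in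
theorem alg_varpi (ωp : BilField E M ℂ) (ω₃ : BilField E M ℝ) (p : P1) (x : M) :
    alg (varpi ωp ω₃ p) x = pointForm (alg ωp x) (alg ω₃ x) p := by
  refine LinearMap.ext fun v => LinearMap.ext fun w => ?_
  rcases infty_or_chart0 p with rfl | ⟨z, rfl⟩
  · rfl
  · rcases eq_or_ne z 0 with rfl | hz
    · rw [varpi_zero, pointForm_zero]
    · rw [alg_apply, varpi_of_ne _ _ hz, pointForm_of_ne _ _ hz]
      rfl

/-- The hypotheses on the twisted family of forms. -/
structure IsHolomorphicSymplecticFamily (ωp : BilField E M ℂ) (ω₃ : BilField E M ℝ) : Prop where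
  zero : IsHolomorphicSymplectic ωp
  twisted : ∀ z : ℂ, z ≠ 0 → IsHolomorphicSymplectic (varpi ωp ω₃ (chart0 z))

namespace IsHolomorphicSymplecticFamily

variable {ωp : BilField E M ℂ} {ω₃ : BilField E M ℝ} (h : IsHolomorphicSymplecticFamily ωp ω₃)
include h

theorem closed_varpi (p : P1) : IsClosedTwoForm (varpi ωp ω₃ p) := by
  rcases infty_or_chart0 p with rfl | ⟨z, rfl⟩
  · exact IsClosedTwoForm.map ⟨h.zero.twoForm, h.zero.closed⟩ (Complex.conjCLE : ℂ →L[ℝ] ℂ)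
      fun x v w => rfl
  · rcases eq_or_ne z 0 with rfl | hz
    · rw [varpi_zero]
      exact ⟨h.zero.twoForm, h.zero.closed⟩
    · exact ⟨(h.twisted z hz).twoForm, (h.twisted z hz).closed⟩

theorem closed_plus : IsClosedTwoForm ωp := ⟨h.zero.twoForm, h.zero.closed⟩

/-- The coefficients of `ω₊` and `ω₋` in `ϖ(ζ)` are odd in `ζ`, so `ω₃` is the mean of `ϖ(1)` and
`ϖ(-1)`. This gives its smoothness, skewness and closedness, none of which is assumed. -/
theorem closed_three : IsClosedTwoForm ω₃ := by
  let L : ℂ →L[ℝ] ℝ := (1 / 2 : ℝ) • Complex.reCLM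
  have h1 : IsClosedTwoForm (postField L (varpi ωp ω₃ (chart0 1))) :=
    (h.closed_varpi _).map L fun x v w => rfl
  have h2 : IsClosedTwoForm (postField L (varpi ωp ω₃ (chart0 (-1)))) :=
    (h.closed_varpi _).map L fun x v w => rfl
  refine h1.add h2 fun x v w => ?_
  rw [varpi_of_ne _ _ one_ne_zero, varpi_of_ne _ _ (neg_ne_zero.2 one_ne_zero)]
  change _ = (1 / 2 : ℝ) * ((-(Complex.I / (2 * 1))) * ωp x v w + (ω₃ x v w : ℂ) -
      (Complex.I / 2 * 1) * starRingEnd ℂ (ωp x v w)).re +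
    (1 / 2 : ℝ) * ((-(Complex.I / (2 * -1))) * ωp x v w + (ω₃ x v w : ℂ) -
      (Complex.I / 2 * -1) * starRingEnd ℂ (ωp x v w)).re
  rw [← mul_add, ← Complex.add_re]
  have e : (-(Complex.I / (2 * 1))) * ωp x v w + (ω₃ x v w : ℂ) -
      (Complex.I / 2 * 1) * starRingEnd ℂ (ωp x v w) +
      ((-(Complex.I / (2 * -1))) * ωp x v w + (ω₃ x v w : ℂ) -
      (Complex.I / 2 * -1) * starRingEnd ℂ (ωp x v w)) = ((2 * ω₃ x v w : ℝ) : ℂ) := by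
    push_cast
    ring
  rw [e, Complex.ofReal_re]
  ring

theorem isTwistedFamily (x : M) : IsTwistedFamily (alg ωp x) (alg ω₃ x) where
  isCompl p := by
    rcases infty_or_chart0 p with rfl | ⟨z, rfl⟩
    · rw [pointForm_infty, conjForm_conjForm]
      exact (h.zero.isCompl x).symm
    · rw [← alg_varpi]
      rcases eq_or_ne z 0 with rfl | hz
      · rw [varpi_zero]
        exact h.zero.isCompl x
      · exact (h.twisted z hz).isCompl x
  skew := h.zero.twoForm.skew x
  skewReal := h.closed_three.twoForm.skew x

variable [FiniteDimensional ℝ E]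

omit h in
omit [IsManifold 𝓘(ℝ, E) ∞ M] in
theorem familyJ_apply (p : P1) (x : M) (v : TangentSpace 𝓘(ℝ, E) x) :
    familyJ ωp ω₃ p x v = pointJ (alg ωp x) (alg ω₃ x) p v := by
  rw [familyJ, alg_varpi]
  rfl

omit h in
omit [IsManifold 𝓘(ℝ, E) ∞ M] in
theorem famAt_eq (x : M) : famAt ωp ω₃ x = pointJ (alg ωp x) (alg ω₃ x) :=
  funext fun p => LinearMap.ext fun v => familyJ_apply p x v

theorem isQuatFamily (x : M) : IsQuatFamily (famAt ωp ω₃ x) := by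
  rw [famAt_eq]
  exact (h.isTwistedFamily x).isQuatFamily

theorem sq (p : P1) (x : M) (v : TangentSpace 𝓘(ℝ, E) x) :
    familyJ ωp ω₃ p x (familyJ ωp ω₃ p x v) = -v := (h.isQuatFamily x).sq p v

theorem tripleJ_anti (x : M) (v : TangentSpace 𝓘(ℝ, E) x) :
    tripleJ ωp ω₃ 2 x (tripleJ ωp ω₃ 0 x v) = -tripleJ ωp ω₃ 0 x (tripleJ ωp ω₃ 2 x v) :=
  (h.isQuatFamily x).anti v

theorem tripleJ_one (x : M) (v : TangentSpace 𝓘(ℝ, E) x) :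
    tripleJ ωp ω₃ 1 x v = tripleJ ωp ω₃ 2 x (tripleJ ωp ω₃ 0 x v) := by
  have := (h.isQuatFamily x).eq_sum (basePt 1) v
  simp only [sphereVec_basePt, Pi.single_apply, Fin.reduceEq, if_true, if_false, zero_smul, one_smul,
    zero_add, add_zero] at this
  exact this

theorem familyJ_eq_sum (p : P1) (x : M) :
    familyJ ωp ω₃ p x = ∑ α, sphereVec p α • tripleJ ωp ω₃ α x := by
  ext v
  rw [Fin.sum_univ_three]
  simp only [add_apply, smul_apply]
  rw [h.tripleJ_one]
  exact (h.isQuatFamily x).eq_sum p v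

theorem twistBil_eq (x : M) (v w : TangentSpace 𝓘(ℝ, E) x) :
    (1 / 2 : ℂ) * (ωp x v (tripleJ ωp ω₃ 0 x w) - ωp x (tripleJ ωp ω₃ 0 x v) w) =
      ((-(ωp x (tripleJ ωp ω₃ 0 x v) w).re : ℝ) : ℂ) := by
  have := (h.isTwistedFamily x).twist_eq v w
  simp only [← familyJ_apply, alg_apply] at this
  exact this

theorem twistMetric_apply (x : M) (v w : TangentSpace 𝓘(ℝ, E) x) :
    twistMetric ωp ω₃ x v w = -(ωp x (tripleJ ωp ω₃ 0 x v) w).re := by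
  have h1 := congrArg Complex.re (h.twistBil_eq x v w)
  rw [Complex.ofReal_re] at h1
  rw [← h1]
  change ((1 / 2 : ℝ) • (ωp x v (tripleJ ωp ω₃ 0 x w) - ωp x (tripleJ ωp ω₃ 0 x v) w)).re = _
  rw [← Complex.coe_smul]
  push_cast
  rfl

theorem twistMetric_eq (x : M) (v w : TangentSpace 𝓘(ℝ, E) x) :
    (twistMetric ωp ω₃ x v w : ℂ) =
      (1 / 2) * (ωp x v (tripleJ ωp ω₃ 0 x w) - ωp x (tripleJ ωp ω₃ 0 x v) w) := by
  rw [h.twistMetric_apply, h.twistBil_eq]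

theorem twistMetric_symm (x : M) (v w : TangentSpace 𝓘(ℝ, E) x) :
    twistMetric ωp ω₃ x v w = twistMetric ωp ω₃ x w v := by
  have := (h.isTwistedFamily x).re_J₁_symm v w
  simp only [← familyJ_apply, alg_apply] at this
  rw [h.twistMetric_apply, h.twistMetric_apply]
  exact congrArg Neg.neg this

theorem tripleForm_eq (α : Fin 3) (x : M) (v w : TangentSpace 𝓘(ℝ, E) x) :
    tripleForm ωp ω₃ α x v w = twistMetric ωp ω₃ x (tripleJ ωp ω₃ α x v) w := by
  have := (h.isTwistedFamily x).re_basePt α v w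
  simp only [← familyJ_apply, alg_apply] at this
  rw [h.twistMetric_apply]
  refine Eq.trans ?_ ((neg_neg _).symm.trans (congrArg Neg.neg this.symm))
  fin_cases α <;> rfl

omit [FiniteDimensional ℝ E] in
theorem nondegenerate_re (x : M) (v : TangentSpace 𝓘(ℝ, E) x)
    (hv : ∀ w, reField ωp x v w = 0) : v = 0 :=
  eq_zero_of_reForm (h.isTwistedFamily x).isCompl_zero (h.isTwistedFamily x).skew hv

theorem twistMetric_nondegenerate (x : M) (v : TangentSpace 𝓘(ℝ, E) x)
    (hv : ∀ w, twistMetric ωp ω₃ x v w = 0) : v = 0 := by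
  have h1 : tripleJ ωp ω₃ 0 x v = 0 := h.nondegenerate_re x _ fun w => by
    have := hv w
    rw [h.twistMetric_apply, neg_eq_zero] at this
    exact this
  have h2 := h.sq (basePt 0) x v
  rw [← neg_eq_zero, ← h2]
  exact (congrArg (tripleJ ωp ω₃ 0 x) h1).trans (map_zero _)

omit [FiniteDimensional ℝ E] in
theorem closed_tripleForm (α : Fin 3) : IsClosedTwoForm (tripleForm ωp ω₃ α) := by
  fin_cases α
  · exact h.closed_plus.map Complex.reCLM fun x v w => rfl
  · exact h.closed_plus.map Complex.imCLM fun x v w => rfl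
  · exact h.closed_three

theorem reForm_tripleJ (α : Fin 3) (x : M) (v w : TangentSpace 𝓘(ℝ, E) x) :
    reField ωp x (tripleJ ωp ω₃ 0 x (tripleJ ωp ω₃ α x v)) w = -tripleForm ωp ω₃ α x v w := by
  rw [h.tripleForm_eq, h.twistMetric_apply, neg_neg]
  rfl

/-- `J₂` and `J₃` are quotients of smooth forms by the nondegenerate `ω₁`, namely `ω₁(J₂v, w) =
ω₃(v, w)` and `ω₁(J₃v, w) = -ω₂(v, w)`. Then `J₁ = J₂J₃`. -/
theorem smooth_tripleJ (α : Fin 3) : SmoothEnd (tripleJ ωp ω₃ α) := by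
  have hre : SmoothBil (reField ωp) := (h.closed_tripleForm 0).twoForm.1
  have h2 : SmoothEnd (tripleJ ωp ω₃ 1) := by
    refine hre.smoothEnd h.closed_three.twoForm.1 h.nondegenerate_re fun x v w => ?_
    rw [h.tripleJ_one, h.tripleJ_anti, map_neg, neg_apply, h.reForm_tripleJ, neg_neg]
    rfl
  have h3 : SmoothEnd (tripleJ ωp ω₃ 2) := by
    refine hre.smoothEnd (C := postField (-Complex.imCLM) ωp)
      (h.closed_plus.twoForm.1.map (-Complex.imCLM) fun x v w => rfl) h.nondegenerate_re fun x v w => ?_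
    have := h.reForm_tripleJ 1 x v w
    rw [h.tripleJ_one, ← neg_neg (tripleJ ωp ω₃ 0 x _), ← h.tripleJ_anti,
      show tripleJ ωp ω₃ 0 x (tripleJ ωp ω₃ 0 x v) = -v from h.sq _ x v, map_neg, map_neg,
      map_neg, neg_neg] at this
    exact this
  fin_cases α
  · refine h2.comp h3 fun x v => ?_
    rw [h.tripleJ_one, ← neg_neg (tripleJ ωp ω₃ 0 x (tripleJ ωp ω₃ 2 x v)), ← h.tripleJ_anti,
      map_neg, show tripleJ ωp ω₃ 2 x (tripleJ ωp ω₃ 2 x _) = _ from h.sq _ x _, neg_neg]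
    rfl
  · exact h2
  · exact h3

theorem smooth_familyJ (p : P1) : SmoothEnd (familyJ ωp ω₃ p) := by
  have hs : ∀ α, SmoothEnd (fun x => sphereVec p α • tripleJ ωp ω₃ α x) := fun α =>
    (h.smooth_tripleJ α).smul _ fun x v => rfl
  have h01 : SmoothEnd (fun x => sphereVec p 0 • tripleJ ωp ω₃ 0 x +
    sphereVec p 1 • tripleJ ωp ω₃ 1 x) := (hs 0).add (hs 1) fun x v => rfl
  refine h01.add (hs 2) fun x v => ?_
  rw [h.familyJ_eq_sum, Fin.sum_univ_three]
  rfl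

theorem isComplexStructure (p : P1) : IsComplexStructure (familyJ ωp ω₃ p) := by
  refine (h.closed_varpi p).isComplexStructure (fun x v hv => ?_) (h.smooth_familyJ p) (h.sq p)
    fun x v w => ?_
  · refine eq_zero_of_isCompl ((h.isTwistedFamily x).isCompl p) fun w => ?_
    rw [← alg_varpi]
    exact hv w
  · have := (h.isTwistedFamily x).form_pointJ p v w
    rw [← alg_varpi, ← familyJ_apply] at this
    exact this

/-- Nondegeneracy: the form is `g(J^(p)v, w)`, with `g` nondegenerate and `J^(p)` invertible. -/
theorem isSymplectic (p : P1) :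
    IsSymplectic (fun x => ∑ α, sphereVec p α • tripleForm ωp ω₃ α x) := by
  have hs : ∀ α, IsClosedTwoForm (fun x => sphereVec p α • tripleForm ωp ω₃ α x) := fun α =>
    (h.closed_tripleForm α).map (sphereVec p α • ContinuousLinearMap.id ℝ ℝ) fun x v w => rfl
  have h01 : IsClosedTwoForm (fun x => sphereVec p 0 • tripleForm ωp ω₃ 0 x +
    sphereVec p 1 • tripleForm ωp ω₃ 1 x) := (hs 0).add (hs 1) fun x v w => rfl
  have hsum : IsClosedTwoForm (fun x => ∑ α, sphereVec p α • tripleForm ωp ω₃ α x) := by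
    refine h01.add (hs 2) fun x v w => ?_
    rw [Fin.sum_univ_three]
    rfl
  refine ⟨hsum.twoForm, hsum.closed, fun x v hv => ?_⟩
  have h1 : familyJ ωp ω₃ p x v = 0 := by
    refine h.twistMetric_nondegenerate x _ fun w => ?_
    rw [← hv w, h.familyJ_eq_sum]
    simp only [Fin.sum_univ_three, add_apply, smul_apply, map_add, map_smul, h.tripleForm_eq]
  rw [← neg_eq_zero, ← h.sq p x v, h1, map_zero]

theorem isPseudoHyperKahler :
    IsPseudoHyperKahler (twistMetric ωp ω₃) (tripleJ ωp ω₃) (tripleForm ωp ω₃) where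
  metric_smooth := by
    have h1 : SmoothBil (postField (-Complex.reCLM) ωp) :=
      h.closed_plus.twoForm.1.map (-Complex.reCLM) fun x v w => rfl
    exact h1.comp_end (h.smooth_tripleJ 0) fun x v w => h.twistMetric_apply x v w
  metric_symm := h.twistMetric_symm
  metric_nondegenerate := h.twistMetric_nondegenerate
  complex α := h.isComplexStructure (basePt α)
  symplectic α := by
    have := h.isSymplectic (basePt α)
    have e : (fun x => ∑ β, sphereVec (basePt α) β • tripleForm ωp ω₃ β x) =
        tripleForm ωp ω₃ α := by
      funext x
      rw [Finset.sum_eq_single α]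
      · rw [sphereVec_basePt, Pi.single_eq_same, one_smul]
      · intro β _ hβ
        rw [sphereVec_basePt, Pi.single_eq_of_ne hβ]
        exact zero_smul ℝ (tripleForm ωp ω₃ β x)
      · simp
    rwa [e] at this
  complex_family p := by
    simp only [← h.familyJ_eq_sum]
    exact h.isComplexStructure p
  symplectic_family := h.isSymplectic
  quaternion α x v := by
    have hsq : ∀ α v, tripleJ ωp ω₃ α x (tripleJ ωp ω₃ α x v) = -v := fun α v => h.sq _ x v
    have h1 := h.tripleJ_one x
    have h2 := h.tripleJ_anti x
    refine ⟨hsq α v, ?_⟩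
    fin_cases α
    · change tripleJ ωp ω₃ 0 x (tripleJ ωp ω₃ 1 x v) = tripleJ ωp ω₃ 2 x v ∧
        tripleJ ωp ω₃ 1 x (tripleJ ωp ω₃ 0 x v) = -tripleJ ωp ω₃ 2 x v
      rw [h1, h1, hsq, h2, map_neg, map_neg, hsq, neg_neg]
      exact ⟨rfl, rfl⟩
    · change tripleJ ωp ω₃ 1 x (tripleJ ωp ω₃ 2 x v) = tripleJ ωp ω₃ 0 x v ∧
        tripleJ ωp ω₃ 2 x (tripleJ ωp ω₃ 1 x v) = -tripleJ ωp ω₃ 0 x v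
      rw [h1, h1, h2, hsq, hsq, map_neg, neg_neg]
      exact ⟨rfl, rfl⟩
    · change tripleJ ωp ω₃ 2 x (tripleJ ωp ω₃ 0 x v) = tripleJ ωp ω₃ 1 x v ∧
        tripleJ ωp ω₃ 0 x (tripleJ ωp ω₃ 2 x v) = -tripleJ ωp ω₃ 1 x v
      rw [h1, h2, neg_neg]
      exact ⟨rfl, rfl⟩
  compatible α x v w := by
    refine ⟨h.tripleForm_eq α x v w, ?_⟩
    rw [(h.closed_tripleForm α).twoForm.skew, h.tripleForm_eq,
      show tripleJ ωp ω₃ α x (tripleJ ωp ω₃ α x w) = -w from h.sq _ x w, map_neg, neg_apply,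
      neg_neg, h.twistMetric_symm]

theorem T01_famAt (x : M) (p : P1) : T01 (famAt ωp ω₃ x p) = kerForm (alg (varpi ωp ω₃ p) x) := by
  rw [famAt_eq, alg_varpi]
  exact (h.isTwistedFamily x).T01_pointJ p

theorem T10_famAt (x : M) (p : P1) :
    T10 (famAt ωp ω₃ x p) = kerForm (conjForm (alg (varpi ωp ω₃ p) x)) := by
  rw [famAt_eq, alg_varpi]
  exact (h.isTwistedFamily x).T10_pointJ p

end IsHolomorphicSymplecticFamily

end TwistedFamilyOnManifold

end HKTwistor

end

/-! ### Coincidence of the two structures -/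

theorem mainTheorem3
    {E : Type*} [NormedAddCommGroup E] [NormedSpace ℝ E] [FiniteDimensional ℝ E]
    {M : Type*} [TopologicalSpace M] [ChartedSpace E M] [IsManifold 𝓘(ℝ, E) ∞ M]
    (ωp : BilField E M ℂ) (ω₃ : BilField E M ℝ)
    (hp : IsHolomorphicSymplectic ωp)
    (hfam : ∀ z : ℂ, z ≠ 0 → IsHolomorphicSymplectic (varpi ωp ω₃ (chart0 z))) :
    -- the structure produced from the family of holomorphic symplectic forms
    IsPseudoHyperKahler (twistMetric ωp ω₃) (tripleJ ωp ω₃) (tripleForm ωp ω₃) ∧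
    (∀ (x : M) (p : P1),
      T01 (famAt ωp ω₃ x p) = kerForm (alg (varpi ωp ω₃ p) x) ∧
      T10 (famAt ωp ω₃ x p) = kerForm (conjForm (alg (varpi ωp ω₃ p) x)) ∧
      familyJ ωp ω₃ p x = ∑ α, sphereVec p α • tripleJ ωp ω₃ α x) ∧
    (∀ (x : M) (v w : TangentSpace 𝓘(ℝ, E) x),
      (twistMetric ωp ω₃ x v w : ℂ) =
        (1 / 2) * (ωp x v (tripleJ ωp ω₃ 0 x w) - ωp x (tripleJ ωp ω₃ 0 x v) w)) ∧
    -- its coincidence with the structure on the space of real twistor lines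
    ∀ x : M,
      (∃ r : ℕ, Module.finrank ℝ (TangentSpace 𝓘(ℝ, E) x) = 4 * r ∧
        NormalBundleIsoO1 (famAt ωp ω₃ x) (2 * r)) ∧
      ∃ j : T10 (famAt ωp ω₃ x (chart0 0)) →ₛₗ[starRingEnd ℂ] T10 (famAt ωp ω₃ x (chart0 0)),
        (IsQuaternionicOperator (famAt ωp ω₃ x) j ∧
          ∀ j', IsQuaternionicOperator (famAt ωp ω₃ x) j' → j' = j) ∧
        (∀ a, (j a : Cplx (TangentSpace 𝓘(ℝ, E) x)) =
          cext (famAt ωp ω₃ x (chart0 Complex.I)) (cconj (a : Cplx (TangentSpace 𝓘(ℝ, E) x)))) ∧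
        ∃ S : TangentData (realHolSections (famAt ωp ω₃ x)),
          (IsHKLR (famAt ωp ω₃ x) (fun p => alg (varpi ωp ω₃ p) x) j S ∧
            ∀ S', IsHKLR (famAt ωp ω₃ x) (fun p => alg (varpi ωp ω₃ p) x) j S' → S' = S) ∧
          ∃ Φ : TangentSpace 𝓘(ℝ, E) x ≃ₗ[ℝ] realHolSections (famAt ωp ω₃ x),
            (∀ v p, (Φ v : P1 → Cplx (TangentSpace 𝓘(ℝ, E) x)) p =
              proj10 (famAt ωp ω₃ x p) (incl v)) ∧
            (∀ v (z : ℂ), coord (famAt ωp ω₃ x) (Φ v) z =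
              proj10 (famAt ωp ω₃ x (chart0 0)) (incl v) -
                z • cext (famAt ωp ω₃ x (chart0 Complex.I))
                  (cconj (proj10 (famAt ωp ω₃ x (chart0 0)) (incl v)))) ∧
            (∀ v w, S.metric (Φ v) (Φ w) = twistMetric ωp ω₃ x v w) ∧
            (∀ p v, S.cplx p (Φ v) = Φ (familyJ ωp ω₃ p x v)) ∧
            (∀ p v w, S.symp p (Φ v) (Φ w) = varpi ωp ω₃ p x v w) ∧
            (∀ α v w, S.kahler α (Φ v) (Φ w) = tripleForm ωp ω₃ α x v w) := by
  have h : IsHolomorphicSymplecticFamily ωp ω₃ := ⟨hp, hfam⟩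
  refine ⟨h.isPseudoHyperKahler,
    fun x p => ⟨h.T01_famAt x p, h.T10_famAt x p, h.familyJ_eq_sum p x⟩, h.twistMetric_eq,
    fun x => ?_⟩
  have hJ := h.isQuatFamily x
  refine ⟨?_, hJ.quatOp, ⟨hJ.isQuaternionicOperator_quatOp, fun j' hj' =>
    IsQuatFamily.quaternionicOperator_unique hJ.isQuaternionicOperator_quatOp hj'⟩,
    hJ.coe_quatOp, ?_⟩
  -- The rank of the normal bundle is half of the real dimension `4r`.
  · obtain ⟨r, hr⟩ := hJ.four_dvd_finrank
    have h10 := two_mul_finrank_T10 (hJ.sq (chart0 0))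
    exact ⟨r, hr, hJ.normalBundleIsoO1 (by omega)⟩
  · obtain ⟨S, hS, hm, hc, hs, hk⟩ := exists_isHKLR hJ (ϖ := fun p => alg (varpi ωp ω₃ p) x)
      (alg (twistMetric ωp ω₃) x) (fun α => alg (tripleForm ωp ω₃ α) x)
      (fun p => (h.closed_varpi p).twoForm.skew x) (h.T01_famAt x)
      (fun v w => by
        simp only [varpi_zero]
        exact h.twistMetric_eq x v w)
      (fun α v w => h.tripleForm_eq α x v w)
    exact ⟨S, hS, hJ.realSectionEquiv, hJ.realSectionEquiv_apply, hJ.coord_realSectionEquiv, hm, hc,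
      hs, hk⟩
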